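/- **Setting.** Let $d\ge 1$ and let $X\subset\mathbb R^d$ be a nonempty compact set with $\overline{\operatorname{int} X}=X$ such that $X$ is convex, or $\partial X$ is a smooth ($C^1$) hypersurface, or, more generally, there are $\alpha\in(0,\pi/2)$, $l>0$ such that every $x\in\partial X$ is the vertex of an open cone of half-angle $\alpha$ and side length $l$ contained in $\operatorname{int}X$. A *non-autonomous conformal iterated function system* (NCIFS) $\Phi$ on $X$ consists, for each $n\ge1$, of a countable index set $I^{(n)}$ and maps $\varphi^{(n)}_i:X\to X$ $(i\in I^{(n)})$ such that 1. $\varphi^{(n)}_a(\operatorname{int}X)\cap\varphi^{(n)}_b(\operatorname{int}X)=\emptyset$ for all $n$ and all $a\ne b$ in $I^{(n)}$; 2. there is an open connected set $V\supset X$ such that every $\varphi^{(n)}_i$ extends to a $C^1$ conformal diffeomorphism of $V$ into $V$; 3. there is $K\ge1$ such that every composition $\varphi=\varphi^{(k)}_{\omega_k}\circ\dots\circ\varphi^{(l)}_{\omega_l}$ $(k\le l$, $\omega_j\in I^{(j)})$ satisfies $|D\varphi(x)|\le K|D\varphi(y)|$ for all $x,y\in V$; 4. there is $\eta\in(0,1)$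 such that for all sufficiently large $m$, all $j\ge1$ and all $\varphi=\varphi^{(j)}_{\omega_j}\circ\dots\circ\varphi^{(j+m)}_{\omega_{j+m}}$ we have $|D\varphi(x)|\le\eta^m$ for all $x\in X$. Here $|D\varphi(x)|$ is the scaling factor of the derivative, and $\|D\varphi\|=\sup_{x\in X}|D\varphi(x)|$. For $\omega\in I^n=I^{(1)}\times\dots\times I^{(n)}$ put $\varphi_\omega=\varphi^{(1)}_{\omega_1}\circ\dots\circ\varphi^{(n)}_{\omega_n}$. The limit set is $J(\Phi)=\bigcap_{n\ge1}\bigcup_{\omega\in I^n}\varphi_\omega(X)$. Put $Z_n(t)=\sum_{\omega\in I^n}\|D\varphi_\omega\|^t$, $\underline P(t)=\liminf_{n\to\infty}\frac1n\log Z_n(t)\in[-\infty,\infty]$ and $Z_1^{(n)}(t)=\sum_{k\in I^{(n)}}\|D\varphi^{(n)}_k\|^t$. The *Bowen dimension* is $B(\Phi)=\sup\{t\ge0:\underline P(t)>0\}$ (with $\sup\emptyset=0$), and *Bowen's formula* holds for $\Phi$ if the Hausdorff dimension of $J(\Phi)$ equals $B(\Phi)$. The system is *infinite* if $I^{(n)}=\mathbb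 N=\{1,2,\dots\}$ for all $n$. * $\Phi\in\mathcal M$ if $\Phi$ is infinite and for all $t\in(0,d)$ and $\varepsilon>0$: (a) the sums $Z_1^{(n)}(t)$ are finite for all $n$ or infinite for all $n$; (b) if they are finite, then $\sum_{k\le e^{\varepsilon n}}\|D\varphi^{(n)}_k\|^t\big/Z_1^{(n)}(t)\to1$ as $n\to\infty$; (c) if they are infinite, then $\sum_{k\le e^{\varepsilon n}}\|D\varphi^{(n)}_k\|^t\to\infty$ as $n\to\infty$. * $\Phi\in\mathrm{EV}$ (*evenly varying*) if $\Phi$ is infinite and there are $\gamma_i>0$ $(i\in\mathbb N)$ and $c\ge1$ with $\gamma_i/c\le\|D\varphi^{(n)}_i\|\le c\,\gamma_i$ for all $i,n$. * $\Phi\in\mathcal M_+$ if every $I^{(n)}$ is a finite or infinite initial segment of $\mathbb N$; the functions $x\mapsto|D\varphi^{(n)}_a(x)|$ on $X$ are uniformly continuous, uniformly in $n$ and $a$; for each $a$, $\|D\varphi^{(n)}_a\|$ is bounded below by a positive constant over all $n$ with $a\in I^{(n)}$; and for all $t\in[0,d]$ and $\delta>0$ there is $M>0$ such that: the sums $Z_1^{(n)}(t)$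 are finite for all $n$ or infinite for all $n$; if finite, then $\sum_{k\le M}\|D\varphi^{(n)}_k\|^t\ge(1-\delta)Z_1^{(n)}(t)$ for all $n$; if infinite, then $\sum_{k\le M}\|D\varphi^{(n)}_k\|^t\ge1/\delta$ for all $n$. **Theorem.** Let $\Phi$ be an NCIFS on $X$. 1. If $\Phi\in\mathcal M$, then Bowen's formula holds for $\Phi$. 2. $\mathrm{EV}\subset\mathcal M$; hence Bowen's formula holds for every $\Phi\in\mathrm{EV}$. 3. Every infinite system in $\mathcal M_+$ belongs to $\mathcal M$, and Bowen's formula holds for every $\Phi\in\mathcal M_+$ (with finite or infinite alphabets). -/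

import Mathlib

open Set Filter Topology
open scoped NNReal ENNReal

noncomputable section

namespace NonAutonomous

/-- The ambient Euclidean space `ℝ^d`. -/
abbrev E (d : ℕ) : Type := EuclideanSpace ℝ (Fin d)

/-- The boundary of `X` is a (`C¹`-)smooth hypersurface: near each of its points it is the zero set
of a `C¹` function whose differential does not vanish at that point. -/
def HasSmoothBoundary {d : ℕ} (X : Set (E d)) : Prop :=
  ∀ p ∈ frontier X, ∃ (U : Set (E d)) (g : E d → ℝ), IsOpen U ∧ p ∈ U ∧
    ContDiffOn ℝ 1 g U ∧ fderiv ℝ g p ≠ 0 ∧ frontier X ∩ U = {x ∈ U | g x = 0}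

/-- The open cone with vertex `x`, axis in the direction of the unit vector `u`, half-angle `α`
and side length `l`. -/
def openCone {d : ℕ} (x u : E d) (α l : ℝ) : Set (E d) :=
  {y | 0 < ‖y - x‖ ∧ ‖y - x‖ < l ∧ Real.cos α * ‖y - x‖ < inner ℝ (y - x) u}

/-- The uniform interior cone condition: every boundary point of `X` is the vertex of a cone of
fixed opening angle and size that is contained in the interior of `X`. -/
def HasConeCondition {d : ℕ} (X : Set (E d)) : Prop :=
  ∃ α l : ℝ, 0 < α ∧ α < Real.pi / 2 ∧ 0 < l ∧
    ∀ x ∈ frontier X, ∃ u : E d, ‖u‖ = 1 ∧ openCone x u α l ⊆ interior X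

/-- The standing assumptions on the phase space `X`. -/
structure IsPhaseSpace {d : ℕ} (X : Set (E d)) : Prop where
  nonempty : X.Nonempty
  isCompact : IsCompact X
  closure_interior : closure (interior X) = X
  geometry : Convex ℝ X ∨ HasSmoothBoundary X ∨ HasConeCondition X

/-- Words `ω_m ω_{m+1} … ω_{m+n-1}` of length `n` starting at level `m`. -/
abbrev Word (I : ℕ → Set ℕ) (m n : ℕ) : Type := (j : Fin n) → I (m + j)

/-- The composition `φ_{ω_m} ∘ φ_{ω_{m+1}} ∘ … ∘ φ_{ω_{m+n-1}}` along a word of length `n` that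
starts at level `m`. -/
def wordMap {d : ℕ} (I : ℕ → Set ℕ) (φ : (n : ℕ) → I n → E d → E d) (m : ℕ) :
    (n : ℕ) → Word I m n → E d → E d
  | 0, _ => id
  | n + 1, ω => wordMap I φ m n (fun j => ω j.castSucc) ∘ φ (m + n) (ω (Fin.last n))

/-- A non-autonomous conformal iterated function system on `X`.

Levels are numbered from `0`, so that `index n` and `map n` are the alphabet `I^{(n+1)}` and the
family `Φ^{(n+1)}` of the usual numbering `n + 1 = 1, 2, 3, …`; the (countable) alphabets are sets
of natural numbers. The maps `X → X` are given together with their conformal extensions to `V`;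
values outside `V` play no role. -/
structure NCIFS {d : ℕ} (X : Set (E d)) where
  /-- The alphabets. -/
  index : ℕ → Set ℕ
  /-- The maps at each level. -/
  map : (n : ℕ) → index n → E d → E d
  /-- The common domain of the conformal extensions. -/
  V : Set (E d)
  isOpen_V : IsOpen V
  isConnected_V : IsConnected V
  subset_V : X ⊆ V
  mapsTo_X : ∀ n i, MapsTo (map n i) X X
  /-- The open set condition. -/
  open_set_condition : ∀ n, ∀ a b : index n, a ≠ b →
    Disjoint (map n a '' interior X) (map n b '' interior X)
  /-- Each map is a `C¹` conformal diffeomorphism of `V` into `V`. -/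
  mapsTo_V : ∀ n i, MapsTo (map n i) V V
  injOn_V : ∀ n i, InjOn (map n i) V
  contDiffOn_V : ∀ n i, ContDiffOn ℝ 1 (map n i) V
  conformalAt_V : ∀ n i, ∀ x ∈ V, ConformalAt (map n i) x
  /-- Bounded distortion. -/
  bounded_distortion : ∃ K : ℝ, 1 ≤ K ∧ ∀ (m n : ℕ) (ω : Word index m n), ∀ x ∈ V, ∀ y ∈ V,
    ‖fderiv ℝ (wordMap index map m n ω) x‖ ≤ K * ‖fderiv ℝ (wordMap index map m n ω) y‖
  /-- Uniform contraction along all sufficiently long words. -/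
  uniform_contraction : ∃ η : ℝ, 0 < η ∧ η < 1 ∧ ∃ N : ℕ, ∀ n ≥ N, ∀ (m : ℕ)
    (ω : Word index m (n + 1)), ∀ x ∈ X, ‖fderiv ℝ (wordMap index map m (n + 1) ω) x‖ ≤ η ^ n

/-- `‖Df‖ = sup {|Df(x)| : x ∈ X}`; for a similarity the operator norm is the scaling factor. -/
def derivNorm {d : ℕ} (X : Set (E d)) (f : E d → E d) : ℝ≥0∞ :=
  ⨆ x ∈ X, ‖fderiv ℝ f x‖ₑ

namespace NCIFS

variable {d : ℕ} {X : Set (E d)} (S : NCIFS X)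

/-- The map `φ_ω` of an initial word `ω` of length `n`. -/
def initialMap (n : ℕ) (ω : Word S.index 0 n) : E d → E d :=
  wordMap S.index S.map 0 n ω

/-- The limit set `J = ⋂_{n ≥ 1} ⋃_{|ω| = n} φ_ω(X)`. -/
def limitSet : Set (E d) :=
  ⋂ n : ℕ, ⋃ ω : Word S.index 0 (n + 1), S.initialMap (n + 1) ω '' X

/-- `Z_n(t) = ∑_{|ω| = n} ‖Dφ_ω‖^t`. -/
def Z (n : ℕ) (t : ℝ) : ℝ≥0∞ :=
  ∑' ω : Word S.index 0 n, derivNorm X (S.initialMap n ω) ^ t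

/-- The lower pressure `liminf (1/n) log Z_n(t)`, with values in `[-∞, ∞]`. -/
def lowerPressure (t : ℝ) : EReal :=
  liminf (fun n : ℕ => ENNReal.log (S.Z n t) / (n : EReal)) atTop

/-- The Bowen dimension `sup {t ≥ 0 : lowerPressure t > 0}`, with `sup ∅ = 0`. -/
def bowenDim : ℝ≥0∞ :=
  ⨆ (t : ℝ≥0) (_ : 0 < S.lowerPressure t), (t : ℝ≥0∞)

/-- Bowen's formula: the limit set has Hausdorff dimension equal to the Bowen dimension. -/
def BowenFormula : Prop :=
  dimH S.limitSet = S.bowenDim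

/-- The level sum `∑_k ‖Dφ_k‖^t` over the alphabet of level `n`. -/
def levelSum (n : ℕ) (t : ℝ) : ℝ≥0∞ :=
  ∑' k : S.index n, derivNorm X (S.map n k) ^ t

/-- The part of the level sum coming from the first `R` letters. Letters are natural numbers
starting from `0`, so the letter `k` is the one with label `k + 1 ∈ {1, 2, 3, …}`. -/
def levelSumUpTo (n : ℕ) (R : ℝ) (t : ℝ) : ℝ≥0∞ :=
  ∑' k : {k : S.index n // ((k : ℕ) : ℝ) + 1 ≤ R}, derivNorm X (S.map n k) ^ t

/-- An infinite system: every alphabet is the whole set of natural numbers. -/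
def IsInfinite : Prop :=
  ∀ n, S.index n = univ

/-- The class `𝓜`. Recall that index `n` stands for the level with number `n + 1`. -/
def InClassM : Prop :=
  S.IsInfinite ∧
  ∀ t : ℝ, 0 < t → t < d → ∀ ε : ℝ, 0 < ε →
    ((∀ n, S.levelSum n t = ⊤) ∨ (∀ n, S.levelSum n t < ⊤)) ∧
    ((∀ n, S.levelSum n t < ⊤) →
      Tendsto (fun n : ℕ =>
        S.levelSumUpTo n (Real.exp (ε * ((n : ℝ) + 1))) t / S.levelSum n t) atTop (𝓝 1)) ∧
    ((∀ n, S.levelSum n t = ⊤) →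
      Tendsto (fun n : ℕ =>
        S.levelSumUpTo n (Real.exp (ε * ((n : ℝ) + 1))) t) atTop (𝓝 ⊤))

/-- The class `EV` of evenly varying systems. -/
def EvenlyVarying : Prop :=
  S.IsInfinite ∧
  ∃ (γ : ℕ → ℝ) (c : ℝ), (∀ i, 0 < γ i) ∧ 1 ≤ c ∧
    ∀ (n : ℕ) (i : S.index n),
      ENNReal.ofReal (γ i / c) ≤ derivNorm X (S.map n i) ∧
      derivNorm X (S.map n i) ≤ ENNReal.ofReal (c * γ i)

/-- The class `𝓜₊`. The alphabets are (finite or infinite) initial segments of the natural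
numbers. -/
def InClassMPlus : Prop :=
  (∀ n, IsLowerSet (S.index n)) ∧
  (∀ ε : ℝ, 0 < ε → ∃ δ : ℝ, 0 < δ ∧ ∀ (n : ℕ) (a : S.index n), ∀ x ∈ X, ∀ y ∈ X,
    dist x y < δ → |‖fderiv ℝ (S.map n a) x‖ - ‖fderiv ℝ (S.map n a) y‖| < ε) ∧
  (∀ a : ℕ, ∃ κ : ℝ, 0 < κ ∧ ∀ (n : ℕ) (ha : a ∈ S.index n),
    ENNReal.ofReal κ ≤ derivNorm X (S.map n ⟨a, ha⟩)) ∧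
  ∀ t : ℝ, 0 ≤ t → t ≤ d → ∀ δ : ℝ, 0 < δ → ∃ M : ℕ, 0 < M ∧
    ((∀ n, S.levelSum n t = ⊤) ∨ (∀ n, S.levelSum n t < ⊤)) ∧
    ((∀ n, S.levelSum n t < ⊤) →
      ∀ n, ENNReal.ofReal (1 - δ) * S.levelSum n t ≤ S.levelSumUpTo n M t) ∧
    ((∀ n, S.levelSum n t = ⊤) →
      ∀ n, ENNReal.ofReal (1 / δ) ≤ S.levelSumUpTo n M t)

end NCIFS

end NonAutonomous

end

/-! Upper bound, valid for every system (`dimH_limitSet_le`): if the lower pressure at `t₁` is not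
positive and `t > t₁`, uniform contraction turns the missing exponential growth at `t₁` into
boundedness of `Z n t` along infinitely many `n`. The images of level `n`, cut into finitely many
pieces each, cover the limit set, so its `t`-dimensional Hausdorff measure is finite.

Lower bound: let the pressure at `t > 0` be positive. Then `t < d`, because volume and the open set
condition bound `Z n d` (`exists_Z_dim_le`). The class conditions allow the alphabets to be
truncated to finite sets `F n` of small exponential growth. The weights `f_n(x) = ∑ |Dφ_ω(x)|^t`
over words of length `n` obey `f_{n+1}(x) = ∑_a |Dφ_a(x)|^t f_n(φ_a x)`, a positive transfer
operator, so an inequality holding at all points of `X` passes to the next level without a further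
distortion factor. Hence truncation costs a factor per level as close to 1 as desired
(`pow_mul_wordSum_le`), or, if the level sums are infinite, the truncated weights can be made to
grow at any chosen rate (`pow_le_wordSum`). In both cases `f_n` outgrows `#F n`.

It remains to see that `∑ #F_n / f_{n+1} < ∞` forces dimension at least `t`
(`le_dimH_limitSet_of_tsum_ne_top`). This is a mass distribution argument on finite levels. At each
level boundedly many words of size above `r` meet a ball of radius `r` (`exists_card_le`, by
interior corkscrews and volume), so the words that first become small near the ball carry at most `C
r^t` of the weight. A cover of the limit set by balls with small `∑ r_i^t` would by compactness
cover a finite stage, and then a proportion below 1 of the weight would be all of it.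

The three classes are handled by checking the truncation hypothesis of `bowenFormula_of_truncation`,
directly or through `InClassM`. -/

namespace NonAutonomous

open MeasureTheory

/-! ### Conformal linear maps: multiplicativity of the norm and the determinant. -/

section Conformal

variable {d : ℕ}

theorem nontrivial_E (hd : 0 < d) : Nontrivial (E d) := by
  have : Nonempty (Fin d) := ⟨⟨0, hd⟩⟩
  infer_instance

theorem norm_smul_linearIsometry (hd : 0 < d) (c : ℝ) (li : E d →ₗᵢ[ℝ] E d) :
    ‖c • li.toContinuousLinearMap‖ = |c| := by
  have := nontrivial_E hd
  rw [norm_smul, LinearIsometry.norm_toContinuousLinearMap, mul_one, Real.norm_eq_abs]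

theorem norm_comp_of_isConformalMap (hd : 0 < d) {f g : E d →L[ℝ] E d}
    (hf : IsConformalMap f) (hg : IsConformalMap g) : ‖f.comp g‖ = ‖f‖ * ‖g‖ := by
  obtain ⟨c, -, lf, rfl⟩ := hf
  obtain ⟨e, -, lg, rfl⟩ := hg
  have h : (c • lf.toContinuousLinearMap).comp (e • lg.toContinuousLinearMap) =
      (c * e) • (lf.comp lg).toContinuousLinearMap := by
    ext x : 1
    simp [mul_smul, smul_comm c e]
  rw [h, norm_smul_linearIsometry hd, norm_smul_linearIsometry hd, norm_smul_linearIsometry hd,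
    abs_mul]

theorem norm_pos_of_isConformalMap (hd : 0 < d) {f : E d →L[ℝ] E d}
    (hf : IsConformalMap f) : 0 < ‖f‖ := by
  obtain ⟨c, hc, lf, rfl⟩ := hf
  rw [norm_smul_linearIsometry hd]
  exact abs_pos.2 hc

theorem surjective_of_isConformalMap {f : E d →L[ℝ] E d} (hf : IsConformalMap f) :
    Function.Surjective f := by
  have := hf.injective
  exact (LinearMap.injective_iff_surjective (f := (f : E d →ₗ[ℝ] E d))).1 this

/-- A linear isometry preserves the unit ball, hence its volume, so its determinant has absolute
value 1; the scaling factor contributes its `d`-th power. -/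
theorem abs_det_of_isConformalMap (hd : 0 < d) {f : E d →L[ℝ] E d}
    (hf : IsConformalMap f) : |f.det| = ‖f‖ ^ d := by
  have := nontrivial_E hd
  obtain ⟨c, hc, li, rfl⟩ := hf
  have hdet : |li.toContinuousLinearMap.det| = 1 := by
    have h := Measure.addHaar_image_continuousLinearMap (volume : Measure (E d))
      li.toContinuousLinearMap (Metric.ball 0 1)
    have h2 : li.toContinuousLinearMap '' Metric.ball (0 : E d) 1 = Metric.ball 0 1 := by
      have := (li.toLinearIsometryEquiv rfl).image_ball (0 : E d) 1
      simpa using this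
    rw [h2] at h
    have hpos : volume (Metric.ball (0 : E d) 1) ≠ 0 := (Metric.measure_ball_pos _ _ one_pos).ne'
    have hfin : volume (Metric.ball (0 : E d) 1) ≠ ⊤ := measure_ball_lt_top.ne
    have h3 : (1 : ℝ≥0∞) = ENNReal.ofReal |li.toContinuousLinearMap.det| := by
      rw [← ENNReal.mul_left_inj hpos hfin, one_mul]
      exact h
    have h4 := congrArg ENNReal.toReal h3
    rw [ENNReal.toReal_ofReal (abs_nonneg _), ENNReal.toReal_one] at h4
    exact h4.symm
  rw [norm_smul_linearIsometry hd]
  have : (c • li.toContinuousLinearMap).det = c ^ d * li.toContinuousLinearMap.det := by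
    simp [ContinuousLinearMap.det, LinearMap.det_smul]
  rw [this, abs_mul, hdet, mul_one, abs_pow]

end Conformal

/-! ### Each of the three geometric alternatives for the phase space gives interior corkscrews. -/

section Corkscrew

variable {d : ℕ} {X : Set (E d)}

/-- The uniform interior corkscrew condition. -/
def HasCorkscrews (X : Set (E d)) : Prop :=
  ∃ κ s₀ : ℝ, 0 < κ ∧ 0 < s₀ ∧ ∀ p ∈ X, ∀ s, 0 < s → s ≤ s₀ →
    ∃ y, Metric.ball y (κ * s) ⊆ interior X ∩ Metric.ball p s

theorem subset_interior_of_isPreconnected {s : Set (E d)} (hs : IsPreconnected s)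
    (hne : (s ∩ interior X).Nonempty) (hf : Disjoint s (frontier X)) : s ⊆ interior X := by
  have h := hs.subset_of_closure_inter_subset isOpen_interior hne
  apply h
  rintro x ⟨hx, hxs⟩
  by_contra hxi
  refine hf.le_bot ⟨hxs, ?_, hxi⟩
  exact closure_mono interior_subset hx

/-- A fixed interior ball is contracted towards `p` with ratio `s / T`. Convexity keeps the
contracted ball in the interior, and `T` exceeds the distance from `p` to any point of the fixed
ball, so the result lies within `s` of `p`. -/
theorem hasCorkscrews_of_convex (hne : (interior X).Nonempty) (hb : Bornology.IsBounded X)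
    (hX : Convex ℝ X) : HasCorkscrews X := by
  obtain ⟨x₀, hx₀⟩ := hne
  obtain ⟨ρ, hρ, hball⟩ := Metric.isOpen_iff.1 isOpen_interior x₀ hx₀
  obtain ⟨D, hD⟩ := (Metric.isBounded_iff_subset_closedBall x₀).1 hb
  have hD0 : 0 ≤ D := dist_nonneg.trans (hD (interior_subset hx₀))
  set T := D + ρ + 1 with hT
  have hTpos : 0 < T := by positivity
  refine ⟨ρ / T, T, by positivity, hTpos, fun p hp s hs hsT => ?_⟩
  set lam := s / T with hlam
  have hl0 : 0 < lam := by positivity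
  have hl1 : lam ≤ 1 := (div_le_one hTpos).2 hsT
  have hlT : lam * T = s := by rw [hlam]; field_simp
  refine ⟨(1 - lam) • p + lam • x₀, ?_⟩
  intro z hz
  have hz' : dist z ((1 - lam) • p + lam • x₀) < ρ * lam := by
    have : ρ / T * s = ρ * lam := by rw [hlam]; ring
    rw [← this]; exact hz
  set w := x₀ + lam⁻¹ • (z - ((1 - lam) • p + lam • x₀)) with hw
  have hwz : z = (1 - lam) • p + lam • w := by
    rw [hw, smul_add, smul_smul, mul_inv_cancel₀ hl0.ne', one_smul]
    abel
  have hwball : w ∈ Metric.ball x₀ ρ := by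
    rw [Metric.mem_ball, dist_eq_norm, hw, add_sub_cancel_left, norm_smul, norm_inv,
      Real.norm_of_nonneg hl0.le, inv_mul_lt_iff₀ hl0, ← dist_eq_norm, mul_comm]
    exact hz'
  constructor
  · rw [hwz]
    exact hX.combo_self_interior_mem_interior hp (hball hwball) (by linarith) hl0 (by ring)
  · have h1 : z - p = lam • (w - p) := by rw [hwz]; module
    rw [Metric.mem_ball, dist_eq_norm, h1, norm_smul, Real.norm_of_nonneg hl0.le, ← dist_eq_norm]
    have h2 : dist w p ≤ dist w x₀ + dist x₀ p := dist_triangle _ _ _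
    have h3 : dist w x₀ < ρ := hwball
    have h4 : dist x₀ p ≤ D := by rw [dist_comm]; exact hD hp
    calc lam * dist w p < lam * T := by
          apply mul_lt_mul_of_pos_left _ hl0
          linarith
      _ = s := hlT

/-- A perturbation `w` of the axis point at distance `ρ / 2` stays in the cone if `c (ρ / 2 + ‖w‖) <
ρ / 2 - ‖w‖` with `c = cos α`; since `1 + c < 2`, the bound `‖w‖ < (1 - c) ρ / 8` is more than
enough. -/
theorem ball_subset_openCone {α : ℝ} (hα0 : 0 < α) (hα : α < Real.pi / 2) {q u : E d}
    (hu : ‖u‖ = 1) {ρ l : ℝ} (hρ : 0 < ρ) (hl : ρ ≤ l) :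
    Metric.ball (q + (ρ / 2) • u) ((1 - Real.cos α) / 8 * ρ) ⊆
      openCone q u α l ∩ Metric.ball q ρ := by
  have hc0 : 0 < Real.cos α := Real.cos_pos_of_mem_Ioo ⟨by linarith, hα⟩
  have hc1 : Real.cos α < 1 := by
    have := Real.cos_lt_cos_of_nonneg_of_le_pi_div_two le_rfl hα.le hα0
    simpa using this
  intro z hz
  set c := Real.cos α
  set w := z - (q + (ρ / 2) • u) with hw
  have hwn : ‖w‖ < (1 - c) / 8 * ρ := by rw [hw, ← dist_eq_norm]; exact hz
  have hzq : z - q = (ρ / 2) • u + w := by rw [hw]; abel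
  have hup : ‖z - q‖ ≤ ρ / 2 + ‖w‖ := by
    rw [hzq]
    refine (norm_add_le _ _).trans ?_
    rw [norm_smul, hu, Real.norm_of_nonneg (by positivity), mul_one]
  have hin : ρ / 2 - ‖w‖ ≤ inner ℝ (z - q) u := by
    rw [hzq, inner_add_left, real_inner_smul_left, real_inner_self_eq_norm_sq, hu]
    have := abs_le.1 (abs_real_inner_le_norm w u)
    rw [hu] at this
    linarith [this.1]
  have hlow : ρ / 2 - ‖w‖ ≤ ‖z - q‖ := by
    refine hin.trans ((real_inner_le_norm _ _).trans ?_)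
    rw [hu, mul_one]
  have hsmall : ‖w‖ < ρ / 8 := by nlinarith
  refine ⟨⟨by linarith, by linarith, ?_⟩, ?_⟩
  · have h5 : c * ‖z - q‖ ≤ c * (ρ / 2 + ‖w‖) := mul_le_mul_of_nonneg_left hup hc0.le
    nlinarith
  · rw [Metric.mem_ball, dist_eq_norm]; linarith

theorem hasCorkscrews_of_coneCondition (hcl : closure (interior X) = X)
    (hX : HasConeCondition X) : HasCorkscrews X := by
  obtain ⟨α, l, hα0, hα, hl, h⟩ := hX
  have hc0 : 0 < Real.cos α := Real.cos_pos_of_mem_Ioo ⟨by linarith, hα⟩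
  have hc1 : Real.cos α < 1 := by
    have := Real.cos_lt_cos_of_nonneg_of_le_pi_div_two le_rfl hα.le hα0
    simpa using this
  -- If the boundary comes within `s / 2` of `p`, a cone of length `s / 2` is used, whence 16
  -- instead of 8. Otherwise the whole ball of radius `s / 2` around `p` is interior.
  refine ⟨(1 - Real.cos α) / 16, l, by linarith, hl, fun p hp s hs hsl => ?_⟩
  by_cases hfr : ∃ q ∈ frontier X, dist q p < s / 2
  · obtain ⟨q, hq, hqp⟩ := hfr
    obtain ⟨u, hu, hcone⟩ := h q hq
    refine ⟨q + (s / 2 / 2) • u, fun z hz => ?_⟩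
    have := ball_subset_openCone hα0 hα (q := q) hu (ρ := s / 2) (l := l) (by linarith)
      (by linarith) (by
        convert hz using 2; ring)
    refine ⟨hcone this.1, ?_⟩
    rw [Metric.mem_ball]
    have h2 : dist z q < s / 2 := this.2
    linarith [dist_triangle z q p]
  · push Not at hfr
    refine ⟨p, ?_⟩
    have hsub : Metric.ball p (s / 2) ⊆ interior X := by
      apply subset_interior_of_isPreconnected (convex_ball p _).isPreconnected
      · have : p ∈ closure (interior X) := by rwa [hcl]
        obtain ⟨y, hy, hyp⟩ := Metric.mem_closure_iff.1 this (s / 2) (by linarith)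
        exact ⟨y, by rwa [Metric.mem_ball, dist_comm], hy⟩
      · rw [Set.disjoint_left]
        intro q hq hq2
        exact absurd hq (by rw [Metric.mem_ball, not_lt]; exact hfr q hq2)
    refine subset_inter ((Metric.ball_subset_ball ?_).trans hsub) (Metric.ball_subset_ball ?_)
    · nlinarith
    · nlinarith

/-- Moving from `q` in a direction close to `u`, the function `g` does not decrease, because its
linear part dominates the error `ε`. It stays positive along the segment, which therefore never
meets the boundary and remains interior. No knowledge of the side on which `X` lies is needed. -/
theorem corkscrew_of_positive_side {g : E d → ℝ} {v : E d →L[ℝ] ℝ} {W : Set (E d)} {u : E d}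
    {ε κ : ℝ} (hg : ∀ x ∈ W, ∀ y ∈ W, |g x - g y - v (x - y)| ≤ ε * ‖x - y‖)
    (hu : v u = 1) (hε : 0 ≤ ε) (hκ : 0 ≤ κ)
    (hsm : ‖v‖ * κ + ε * (‖u‖ + κ) < 1) (hW : frontier X ∩ W ⊆ {x | g x = 0})
    {q : E d} (hq : q ∈ interior X) (hgq : 0 < g q) {s : ℝ} (hs : 0 < s)
    (hsW : Metric.ball q (s * (‖u‖ + κ + 1)) ⊆ W) :
    Metric.ball (q + s • u) (κ * s) ⊆ interior X := by
  intro z hz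
  set w := s⁻¹ • (z - (q + s • u)) with hw
  have hwn : ‖w‖ ≤ κ := by
    rw [hw, norm_smul, norm_inv, Real.norm_of_nonneg hs.le, inv_mul_le_iff₀ hs, ← dist_eq_norm,
      mul_comm]
    exact (Metric.mem_ball.1 hz).le
  have hzq : z = q + s • (u + w) := by
    rw [hw, smul_add, smul_smul, mul_inv_cancel₀ hs.ne', one_smul]; abel
  have hnn : ‖u + w‖ ≤ ‖u‖ + κ := (norm_add_le _ _).trans (by linarith)
  have hnu := norm_nonneg u
  have hmem : ∀ y ∈ segment ℝ q z, y ∈ W ∧ 0 < g y := by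
    intro y hy
    rw [segment_eq_image'] at hy
    obtain ⟨θ, ⟨hθ0, hθ1⟩, rfl⟩ := hy
    have e1 : q + θ • (z - q) - q = (θ * s) • (u + w) := by
      rw [hzq]; module
    have hθs : 0 ≤ θ * s := by positivity
    have hθs1 : θ * s ≤ s := by nlinarith
    have hnorm : ‖q + θ • (z - q) - q‖ ≤ θ * s * (‖u‖ + κ) := by
      rw [e1, norm_smul, Real.norm_of_nonneg hθs]
      exact mul_le_mul_of_nonneg_left hnn hθs
    have hyW : q + θ • (z - q) ∈ W := by
      apply hsW
      rw [Metric.mem_ball, dist_eq_norm]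
      refine hnorm.trans_lt ?_
      nlinarith
    have hqW : q ∈ W := hsW (Metric.mem_ball_self (by positivity))
    refine ⟨hyW, ?_⟩
    have h1 := (abs_le.1 (hg _ hyW _ hqW)).1
    have h2 : v (q + θ • (z - q) - q) = θ * s * (1 + v w) := by
      rw [e1, map_smul, map_add, hu, smul_eq_mul]
    have h3 : |v w| ≤ ‖v‖ * κ := (v.le_opNorm w).trans
      (mul_le_mul_of_nonneg_left hwn (norm_nonneg _))
    have h4 := (abs_le.1 h3).1
    have h5 : ε * ‖q + θ • (z - q) - q‖ ≤ ε * (θ * s * (‖u‖ + κ)) :=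
      mul_le_mul_of_nonneg_left hnorm hε
    rw [h2] at h1
    have h6 : 0 ≤ θ * s * ((1 + v w) - ε * (‖u‖ + κ)) := mul_nonneg hθs (by linarith)
    nlinarith
  have hsub := subset_interior_of_isPreconnected (X := X) (convex_segment q z).isPreconnected
    ⟨q, left_mem_segment _ _ _, hq⟩ (by
      rw [Set.disjoint_left]
      intro y hy hyf
      have := hmem y hy
      exact this.2.ne' (hW ⟨hyf, this.1⟩))
  exact hsub (right_mem_segment _ _ _)

theorem corkscrew_near_smooth_boundary_point (hcl : closure (interior X) = X)
    {p : E d} {U : Set (E d)} {g : E d → ℝ} (hU : IsOpen U) (hpU : p ∈ U)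
    (hg : ContDiffOn ℝ 1 g U) (hgp : fderiv ℝ g p ≠ 0)
    (hfr : frontier X ∩ U = {x ∈ U | g x = 0}) :
    ∃ ρ > 0, ∃ κ > 0, ∃ s₀ > 0, ∀ q ∈ X ∩ Metric.ball p ρ, ∀ s, 0 < s → s ≤ s₀ →
      ∃ y, Metric.ball y (κ * s) ⊆ interior X ∩ Metric.ball q s := by
  set v := fderiv ℝ g p with hv
  obtain ⟨u, hu⟩ : ∃ u, v u = 1 := by
    obtain ⟨u, hu⟩ : ∃ u, v u ≠ 0 := by
      by_contra! hcon
      exact hgp (ContinuousLinearMap.ext hcon)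
    exact ⟨(v u)⁻¹ • u, by simp [hu]⟩
  have hnu := norm_nonneg u
  have hnv := norm_nonneg v
  set κ : ℝ := min 1 (1 / (4 * (‖v‖ + 1))) with hκ
  have hκ0 : 0 < κ := by positivity
  have hκ1 : κ ≤ 1 := min_le_left _ _
  have hκv : ‖v‖ * κ ≤ 1 / 4 := by
    have h1 : κ ≤ 1 / (4 * (‖v‖ + 1)) := min_le_right _ _
    rw [le_div_iff₀ (by positivity)] at h1
    nlinarith
  set ε : ℝ := 1 / (4 * (‖u‖ + 1)) with hε
  have hε0 : 0 < ε := by positivity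
  have hεu : ε * (‖u‖ + κ) ≤ 1 / 4 := by
    have h1 : ε * (4 * (‖u‖ + 1)) = 1 := by rw [hε]; field_simp
    nlinarith
  have hstrict : HasStrictFDerivAt g v p :=
    (hg.contDiffAt (hU.mem_nhds hpU)).hasStrictFDerivAt one_ne_zero
  have hnear := hstrict.isLittleO.def hε0
  rw [nhds_prod_eq] at hnear
  obtain ⟨W', hW', hgW''⟩ := mem_prod_same_iff.1 hnear
  have hgW' : ∀ x ∈ W', ∀ y ∈ W', ‖g x - g y - v (x - y)‖ ≤ ε * ‖x - y‖ :=
    fun x hx y hy => hgW'' (mk_mem_prod hx hy)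
  obtain ⟨R, hR, hRW⟩ := Metric.mem_nhds_iff.1 (inter_mem hW' (hU.mem_nhds hpU))
  set N : ℝ := ‖u‖ + κ + 1 with hN
  have hN0 : 0 < N := by positivity
  refine ⟨R / 4, by positivity, κ / (4 * N), by positivity, R, hR, ?_⟩
  rintro q ⟨hqX, hqp⟩ s hs hsR
  -- The point `q` may lie on the boundary, so the construction starts from a nearby interior point
  -- `q'`. There `g` cannot vanish, and its sign decides between the directions `u` and `-u`.
  obtain ⟨q', hq', hqq'⟩ := Metric.mem_closure_iff.1 (by rwa [hcl] : q ∈ closure (interior X))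
    (s / 4) (by linarith)
  have hq'p : dist q' p < R / 2 := by
    have h1 := dist_triangle q' q p
    rw [dist_comm q' q] at h1
    have h2 : dist q p < R / 4 := hqp
    linarith
  -- With this step length the corkscrew stays within `s / 4` of `q'`, hence within `s / 2` of `q`.
  set σ := s / (4 * N) with hσ
  have hσ0 : 0 < σ := by positivity
  have hσN : σ * N = s / 4 := by rw [hσ]; field_simp
  have hsub : Metric.ball q' (σ * (‖u‖ + κ + 1)) ⊆ Metric.ball p R := by
    intro z hz
    rw [Metric.mem_ball] at hz ⊢
    have := dist_triangle z q' p
    have h3 : dist z q' < s / 4 := by rw [← hσN]; exact hz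
    linarith
  have hq'U : q' ∈ U := (hRW (by rw [Metric.mem_ball]; linarith)).2
  have hgq' : g q' ≠ 0 := by
    intro h0
    have : q' ∈ frontier X ∩ U := by rw [hfr]; exact ⟨hq'U, h0⟩
    exact this.1.2 hq'
  have hW : frontier X ∩ Metric.ball p R ⊆ {x | g x = 0} := by
    rintro x ⟨hx, hxR⟩
    have : x ∈ {x ∈ U | g x = 0} := by rw [← hfr]; exact ⟨hx, (hRW hxR).2⟩
    exact this.2
  have hκσ : κ / (4 * N) * s = κ * σ := by rw [hσ]; ring
  obtain ⟨u', hu'n, hball⟩ : ∃ u', ‖u'‖ = ‖u‖ ∧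
      Metric.ball (q' + σ • u') (κ * σ) ⊆ interior X := by
    rcases hgq'.lt_or_gt with hneg | hpos
    · refine ⟨-u, norm_neg u, ?_⟩
      refine corkscrew_of_positive_side (g := fun x => - g x) (v := -v) (W := Metric.ball p R)
        (ε := ε) (fun x hx y hy => ?_) (by simp [hu]) hε0.le hκ0.le ?_ ?_ hq' (by linarith) hσ0
        (by rwa [norm_neg])
      · have := hgW' _ (hRW hx).1 _ (hRW hy).1
        rw [Real.norm_eq_abs] at this
        rw [← abs_neg]
        convert this using 2
        simp; ring
      · rw [norm_neg, norm_neg]; linarith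
      · intro x hx
        have := hW hx
        simpa using this
    · refine ⟨u, rfl, ?_⟩
      refine corkscrew_of_positive_side (g := g) (v := v) (W := Metric.ball p R)
        (ε := ε) (fun x hx y hy => ?_) hu hε0.le hκ0.le (by linarith) hW hq' hpos hσ0 hsub
      exact hgW' _ (hRW hx).1 _ (hRW hy).1
  refine ⟨q' + σ • u', subset_inter (by rw [hκσ]; exact hball) ?_⟩
  intro z hz
  rw [hκσ, Metric.mem_ball] at hz
  rw [Metric.mem_ball]
  have h1 : dist (q' + σ • u') q' = σ * ‖u‖ := by
    rw [dist_eq_norm, add_sub_cancel_left, norm_smul, hu'n, Real.norm_of_nonneg hσ0.le]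
  have h2 := dist_triangle z (q' + σ • u') q'
  have h3 := dist_triangle z q' q
  rw [dist_comm q' q] at h3
  have h4 : σ * N = σ * ‖u‖ + κ * σ + σ := by rw [hN]; ring
  linarith

theorem hasCorkscrews_of_smoothBoundary (hc : IsCompact X) (hcl : closure (interior X) = X)
    (hX : HasSmoothBoundary X) : HasCorkscrews X := by
  have hloc : ∀ p ∈ X, ∃ ρ > 0, ∃ κ > 0, ∃ s₀ > 0, ∀ q ∈ X ∩ Metric.ball p ρ, ∀ s, 0 < s → s ≤ s₀ →
      ∃ y, Metric.ball y (κ * s) ⊆ interior X ∩ Metric.ball q s := by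
    intro p hp
    by_cases hfr : p ∈ frontier X
    · obtain ⟨U, g, hU, hpU, hg, hgp, hfrU⟩ := hX p hfr
      exact corkscrew_near_smooth_boundary_point hcl hU hpU hg hgp hfrU
    · have hpi : p ∈ interior X := by
        by_contra hni
        exact hfr ⟨subset_closure hp, hni⟩
      obtain ⟨R, hR, hRX⟩ := Metric.isOpen_iff.1 isOpen_interior p hpi
      refine ⟨R / 2, by positivity, 1, one_pos, R / 2, by positivity, ?_⟩
      rintro q ⟨-, hq⟩ s hs hsR
      refine ⟨q, ?_⟩
      rw [one_mul]
      refine subset_inter (fun z hz => hRX ?_) subset_rfl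
      rw [Metric.mem_ball] at hz hq ⊢
      linarith [dist_triangle z q p]
  choose! ρ hρ κ hκ s₀ hs₀ h using hloc
  obtain ⟨t, htX, htc⟩ := hc.elim_nhds_subcover (fun p => Metric.ball p (ρ p))
    (fun p hp => Metric.ball_mem_nhds p (hρ p hp))
  rcases t.eq_empty_or_nonempty with rfl | hne
  · refine ⟨1, 1, one_pos, one_pos, fun p hp => ?_⟩
    have := htc hp
    simp at this
  · refine ⟨t.inf' hne κ, t.inf' hne s₀, ?_, ?_, ?_⟩
    · rw [Finset.lt_inf'_iff]; exact fun p hp => hκ p (htX p hp)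
    · rw [Finset.lt_inf'_iff]; exact fun p hp => hs₀ p (htX p hp)
    · intro q hq s hs hss
      obtain ⟨p, hpt, hqp⟩ := mem_iUnion₂.1 (htc hq)
      obtain ⟨y, hy⟩ := h p (htX p hpt) q ⟨hq, hqp⟩ s hs (hss.trans (Finset.inf'_le _ hpt))
      refine ⟨y, (Metric.ball_subset_ball ?_).trans hy⟩
      exact mul_le_mul_of_nonneg_right (Finset.inf'_le _ hpt) hs.le

theorem IsPhaseSpace.hasCorkscrews (hX : IsPhaseSpace X) : HasCorkscrews X := by
  rcases hX.geometry with h | h | h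
  · refine hasCorkscrews_of_convex ?_ hX.isCompact.isBounded h
    rw [← closure_nonempty_iff, hX.closure_interior]
    exact hX.nonempty
  · exact hasCorkscrews_of_smoothBoundary hX.isCompact hX.closure_interior h
  · exact hasCorkscrews_of_coneCondition hX.closure_interior h

end Corkscrew

/-! ### Words split into an initial part and a last letter. -/

section Words

variable {I : ℕ → Set ℕ} {n : ℕ}

/-- The word without its last letter. -/
def wordInit (ω : Word I 0 (n + 1)) : Word I 0 n := fun j => ω j.castSucc

/-- The last letter of a word. -/
def wordLast (ω : Word I 0 (n + 1)) : I (0 + n) := ω (Fin.last n)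

/-- Appending a letter to a word. -/
def wordEquiv (I : ℕ → Set ℕ) (n : ℕ) : I (0 + n) × Word I 0 n ≃ Word I 0 (n + 1) :=
  Fin.snocEquiv (fun j : Fin (n + 1) => (I (0 + j) : Type))

@[simp] theorem wordInit_wordEquiv (p : I (0 + n) × Word I 0 n) :
    wordInit (wordEquiv I n p) = p.2 := by
  funext j
  exact Fin.snoc_castSucc (α := fun j : Fin (n + 1) => (I (0 + j) : Type)) p.1 p.2 j

@[simp] theorem wordLast_wordEquiv (p : I (0 + n) × Word I 0 n) :
    wordLast (wordEquiv I n p) = p.1 :=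
  Fin.snoc_last (α := fun j : Fin (n + 1) => (I (0 + j) : Type)) p.1 p.2

theorem word_ext {ω ω' : Word I 0 (n + 1)} (h1 : wordInit ω = wordInit ω')
    (h2 : wordLast ω = wordLast ω') : ω = ω' := by
  funext j
  refine Fin.lastCases ?_ (fun i => ?_) j
  · exact h2
  · exact congrFun h1 i

theorem tsum_word_succ (G : Word I 0 (n + 1) → ℝ≥0∞) :
    ∑' ω, G ω = ∑' a : I (0 + n), ∑' ω : Word I 0 n, G (wordEquiv I n (a, ω)) := by
  rw [← (wordEquiv I n).tsum_eq, ENNReal.tsum_prod']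

end Words

/-! ### Derivatives along words, bounded distortion and the chain rule. -/

namespace NCIFS

variable {d : ℕ} {X : Set (E d)} (S : NCIFS X)

/-- The scaling factor `|Dφ_ω(x)|`. -/
noncomputable def wordDeriv (n : ℕ) (ω : Word S.index 0 n) (x : E d) : ℝ≥0∞ :=
  ‖fderiv ℝ (S.initialMap n ω) x‖ₑ

/-- The norm `‖Dφ_ω‖`. -/
noncomputable def wordNorm (n : ℕ) (ω : Word S.index 0 n) : ℝ≥0∞ :=
  derivNorm X (S.initialMap n ω)

/-- The scaling factor `|Dφ_a(x)|` of a single map. -/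
noncomputable def letterDeriv (n : ℕ) (a : S.index n) (x : E d) : ℝ≥0∞ :=
  ‖fderiv ℝ (S.map n a) x‖ₑ

/-- The norm `‖Dφ_a‖` of a single map. -/
noncomputable def letterNorm (n : ℕ) (a : S.index n) : ℝ≥0∞ :=
  derivNorm X (S.map n a)

/-- `K` is a distortion constant for the initial words and for the single maps. -/
structure IsDistortion (K : ℝ≥0) : Prop where
  one_le : 1 ≤ K
  word : ∀ n ω, ∀ x ∈ S.V, ∀ y ∈ S.V, S.wordDeriv n ω x ≤ K * S.wordDeriv n ω y
  letter : ∀ n a, ∀ x ∈ S.V, ∀ y ∈ S.V, S.letterDeriv n a x ≤ K * S.letterDeriv n a y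

theorem enorm_le_of_norm_le_mul {F : Type*} [NormedAddCommGroup F] {u v : F} {K : ℝ} (hK : 0 ≤ K)
    (h : ‖u‖ ≤ K * ‖v‖) : ‖u‖ₑ ≤ (K.toNNReal : ℝ≥0∞) * ‖v‖ₑ := by
  rw [← ofReal_norm, ← ofReal_norm, ← ENNReal.ofReal, ← ENNReal.ofReal_mul hK]
  exact ENNReal.ofReal_le_ofReal h

theorem exists_isDistortion : ∃ K, S.IsDistortion K := by
  obtain ⟨K, hK1, hK⟩ := S.bounded_distortion
  refine ⟨K.toNNReal, ⟨by simpa using hK1, fun n ω x hx y hy => ?_, fun n a x hx y hy => ?_⟩⟩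
  · exact enorm_le_of_norm_le_mul (by linarith) (hK 0 n ω x hx y hy)
  · have h := hK n 1 (fun j => ⟨a, by
      have : (j : ℕ) = 0 := by omega
      rw [this]; exact a.2⟩) x hx y hy
    exact enorm_le_of_norm_le_mul (by linarith) h

theorem initialMap_succ (n : ℕ) (ω : Word S.index 0 (n + 1)) :
    S.initialMap (n + 1) ω = S.initialMap n (wordInit ω) ∘ S.map (0 + n) (wordLast ω) := rfl

theorem initialMap_mapsTo_V : ∀ n ω, MapsTo (S.initialMap n ω) S.V S.V
  | 0, _ => mapsTo_id _
  | n + 1, ω => (initialMap_mapsTo_V n (wordInit ω)).comp (S.mapsTo_V _ _)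

theorem initialMap_mapsTo_X : ∀ n ω, MapsTo (S.initialMap n ω) X X
  | 0, _ => mapsTo_id _
  | n + 1, ω => (initialMap_mapsTo_X n (wordInit ω)).comp (S.mapsTo_X _ _)

theorem initialMap_injOn : ∀ n ω, InjOn (S.initialMap n ω) S.V
  | 0, _ => injOn_id _
  | n + 1, ω => (initialMap_injOn n (wordInit ω)).comp (S.injOn_V _ _) (S.mapsTo_V _ _)

theorem initialMap_conformalAt : ∀ n ω, ∀ x ∈ S.V, ConformalAt (S.initialMap n ω) x
  | 0, _, x, _ => conformalAt_id x
  | n + 1, ω, x, hx =>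
    (initialMap_conformalAt n (wordInit ω) _ (S.mapsTo_V _ _ hx)).comp x
      (S.conformalAt_V _ _ x hx)

theorem initialMap_continuousOn (n ω) : ContinuousOn (S.initialMap n ω) S.V :=
  fun x hx => (S.initialMap_conformalAt n ω x hx).differentiableAt.continuousAt.continuousWithinAt

theorem wordDeriv_zero (hd : 0 < d) (ω : Word S.index 0 0) (x : E d) : S.wordDeriv 0 ω x = 1 := by
  have := nontrivial_E hd
  have h : fderiv ℝ (S.initialMap 0 ω) x = ContinuousLinearMap.id ℝ (E d) := fderiv_id
  rw [wordDeriv, h, ← ofReal_norm, ContinuousLinearMap.norm_id, ENNReal.ofReal_one]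

theorem wordDeriv_succ (hd : 0 < d) (n : ℕ) (ω : Word S.index 0 (n + 1)) {x : E d}
    (hx : x ∈ S.V) : S.wordDeriv (n + 1) ω x =
      S.wordDeriv n (wordInit ω) (S.map (0 + n) (wordLast ω) x) *
        S.letterDeriv (0 + n) (wordLast ω) x := by
  have h1 := S.initialMap_conformalAt n (wordInit ω) _ (S.mapsTo_V (0 + n) (wordLast ω) hx)
  have h2 := S.conformalAt_V (0 + n) (wordLast ω) x hx
  rw [wordDeriv, initialMap_succ, fderiv_comp x h1.differentiableAt h2.differentiableAt,
    ← ofReal_norm, norm_comp_of_isConformalMap hd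
      (conformalAt_iff_isConformalMap_fderiv.1 h1) (conformalAt_iff_isConformalMap_fderiv.1 h2),
    ENNReal.ofReal_mul (norm_nonneg _), ofReal_norm, ofReal_norm]
  rfl

theorem wordDeriv_ne_zero (hd : 0 < d) (n : ℕ) (ω : Word S.index 0 n) {x : E d}
    (hx : x ∈ S.V) : S.wordDeriv n ω x ≠ 0 := by
  rw [wordDeriv, ← ofReal_norm, Ne, ENNReal.ofReal_eq_zero, not_le]
  exact norm_pos_of_isConformalMap hd
    (conformalAt_iff_isConformalMap_fderiv.1 (S.initialMap_conformalAt n ω x hx))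

theorem letterDeriv_ne_zero (hd : 0 < d) (n : ℕ) (a : S.index n) {x : E d}
    (hx : x ∈ S.V) : S.letterDeriv n a x ≠ 0 := by
  rw [letterDeriv, ← ofReal_norm, Ne, ENNReal.ofReal_eq_zero, not_le]
  exact norm_pos_of_isConformalMap hd
    (conformalAt_iff_isConformalMap_fderiv.1 (S.conformalAt_V n a x hx))

theorem wordDeriv_ne_top (n : ℕ) (ω : Word S.index 0 n) (x : E d) : S.wordDeriv n ω x ≠ ⊤ :=
  enorm_ne_top

theorem wordDeriv_le_wordNorm (n : ℕ) (ω : Word S.index 0 n) {x : E d} (hx : x ∈ X) :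
    S.wordDeriv n ω x ≤ S.wordNorm n ω :=
  le_iSup₂ (f := fun x (_ : x ∈ X) => ‖fderiv ℝ (S.initialMap n ω) x‖ₑ) x hx

theorem letterDeriv_le_letterNorm (n : ℕ) (a : S.index n) {x : E d} (hx : x ∈ X) :
    S.letterDeriv n a x ≤ S.letterNorm n a :=
  le_iSup₂ (f := fun x (_ : x ∈ X) => ‖fderiv ℝ (S.map n a) x‖ₑ) x hx

variable {S} in
theorem IsDistortion.wordNorm_le {K : ℝ≥0} (hK : S.IsDistortion K) (n : ℕ)
    (ω : Word S.index 0 n) {y : E d} (hy : y ∈ S.V) :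
    S.wordNorm n ω ≤ K * S.wordDeriv n ω y :=
  iSup₂_le fun x hx => hK.word n ω x (S.subset_V hx) y hy

variable {S} in
theorem IsDistortion.letterNorm_le {K : ℝ≥0} (hK : S.IsDistortion K) (n : ℕ)
    (a : S.index n) {y : E d} (hy : y ∈ S.V) :
    S.letterNorm n a ≤ K * S.letterDeriv n a y :=
  iSup₂_le fun x hx => hK.letter n a x (S.subset_V hx) y hy

variable {S} in
theorem IsDistortion.wordDeriv_le {K : ℝ≥0} (hK : S.IsDistortion K) (n : ℕ)
    (ω : Word S.index 0 n) {y : E d} (hy : y ∈ S.V) (hne : X.Nonempty) :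
    S.wordDeriv n ω y ≤ K * S.wordNorm n ω := by
  obtain ⟨x, hx⟩ := hne
  refine (hK.word n ω y hy x (S.subset_V hx)).trans ?_
  gcongr
  exact S.wordDeriv_le_wordNorm n ω hx

theorem wordNorm_ne_top (hne : X.Nonempty) (n : ℕ) (ω : Word S.index 0 n) :
    S.wordNorm n ω ≠ ⊤ := by
  obtain ⟨K, hK⟩ := S.exists_isDistortion
  obtain ⟨x, hx⟩ := hne
  exact ne_top_of_le_ne_top (ENNReal.mul_ne_top ENNReal.coe_ne_top (S.wordDeriv_ne_top n ω x))
    (hK.wordNorm_le n ω (S.subset_V hx))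

theorem wordNorm_ne_zero (hd : 0 < d) (hne : X.Nonempty) (n : ℕ) (ω : Word S.index 0 n) :
    S.wordNorm n ω ≠ 0 := by
  obtain ⟨x, hx⟩ := hne
  have h := S.wordDeriv_le_wordNorm n ω hx
  intro h0
  rw [h0] at h
  exact S.wordDeriv_ne_zero hd n ω (S.subset_V hx) (nonpos_iff_eq_zero.1 h)

theorem wordNorm_zero (hd : 0 < d) (hne : X.Nonempty) (ω : Word S.index 0 0) :
    S.wordNorm 0 ω = 1 := by
  apply le_antisymm
  · exact iSup₂_le fun x _ => (S.wordDeriv_zero hd ω x).le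
  · obtain ⟨x, hx⟩ := hne
    rw [← S.wordDeriv_zero hd ω x]
    exact S.wordDeriv_le_wordNorm 0 ω hx

theorem exists_wordNorm_le : ∃ η : ℝ, 0 < η ∧ η < 1 ∧ ∃ N : ℕ, ∀ n ≥ N,
    ∀ ω : Word S.index 0 (n + 1), S.wordNorm (n + 1) ω ≤ ENNReal.ofReal (η ^ n) := by
  obtain ⟨η, h0, h1, N, h⟩ := S.uniform_contraction
  refine ⟨η, h0, h1, N, fun n hn ω => iSup₂_le fun x hx => ?_⟩
  rw [← ofReal_norm]
  exact ENNReal.ofReal_le_ofReal (h n hn 0 ω x hx)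

/-! ### Disjoint images, volume and counting. -/

/-- The derivative is invertible, so the map is open at interior points and sends a neighbourhood
contained in `X` onto a neighbourhood contained in `X`. -/
theorem map_image_interior_subset (n : ℕ) (a : S.index n) :
    S.map n a '' interior X ⊆ interior X := by
  rintro _ ⟨x, hx, rfl⟩
  have hxV : x ∈ S.V := S.subset_V (interior_subset hx)
  have hs : HasStrictFDerivAt (S.map n a) (fderiv ℝ (S.map n a) x) x :=
    ((S.contDiffOn_V n a).contDiffAt (S.isOpen_V.mem_nhds hxV)).hasStrictFDerivAt one_ne_zero
  have hsurj : (fderiv ℝ (S.map n a) x).range = ⊤ :=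
    LinearMap.range_eq_top.2 (surjective_of_isConformalMap
      (conformalAt_iff_isConformalMap_fderiv.1 (S.conformalAt_V n a x hxV)))
  have hmap := hs.map_nhds_eq_of_surj hsurj
  rw [mem_interior_iff_mem_nhds, ← hmap]
  exact mem_map.2 (mem_of_superset (mem_interior_iff_mem_nhds.1 hx) (S.mapsTo_X n a))

/-- If the prefixes differ, the images are contained in those of the prefixes, which are disjoint by
induction. If they agree, the last letters differ, and injectivity on `V` transports the open set
condition. -/
theorem disjoint_initialMap_image : ∀ n, ∀ ω ω' : Word S.index 0 n, ω ≠ ω' →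
    Disjoint (S.initialMap n ω '' interior X) (S.initialMap n ω' '' interior X)
  | 0, ω, ω', h => (h (Subsingleton.elim _ _)).elim
  | n + 1, ω, ω', h => by
    rw [initialMap_succ, initialMap_succ, image_comp, image_comp]
    by_cases h1 : wordInit ω = wordInit ω'
    · have h2 : wordLast ω ≠ wordLast ω' := fun h2 => h (word_ext h1 h2)
      rw [h1]
      refine (S.open_set_condition (0 + n) _ _ h2).image (u := S.V)
        (S.initialMap_injOn n (wordInit ω')) ?_ ?_ <;>
      exact (S.map_image_interior_subset _ _).trans (interior_subset.trans S.subset_V)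
    · exact (disjoint_initialMap_image n _ _ h1).mono
        (image_mono (S.map_image_interior_subset _ _))
        (image_mono (S.map_image_interior_subset _ _))

theorem measurableSet_initialMap_image (n : ℕ) (ω : Word S.index 0 n) {A : Set (E d)}
    (hA : MeasurableSet A) (hAV : A ⊆ S.V) : MeasurableSet (S.initialMap n ω '' A) :=
  hA.image_of_continuousOn_injOn ((S.initialMap_continuousOn n ω).mono hAV)
    ((S.initialMap_injOn n ω).mono hAV)

variable {S} in
theorem IsDistortion.volume_image {K : ℝ≥0} (hK : S.IsDistortion K) (hd : 0 < d) (n : ℕ)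
    (ω : Word S.index 0 n) {A : Set (E d)} (hA : MeasurableSet A) (hAV : A ⊆ S.V) :
    S.wordNorm n ω ^ d * volume A ≤ (K : ℝ≥0∞) ^ d * volume (S.initialMap n ω '' A) := by
  rw [← lintegral_abs_det_fderiv_eq_addHaar_image volume hA
    (f' := fun x => fderiv ℝ (S.initialMap n ω) x)
    (fun x hx => (S.initialMap_conformalAt n ω x
      (hAV hx)).differentiableAt.hasFDerivAt.hasFDerivWithinAt)
    ((S.initialMap_injOn n ω).mono hAV)]
  have hKd : (K : ℝ≥0∞) ^ d ≠ ⊤ := ENNReal.pow_ne_top ENNReal.coe_ne_top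
  rw [← lintegral_const_mul' _ _ hKd, ← setLIntegral_const]
  refine setLIntegral_mono' hA fun x hx => ?_
  rw [abs_det_of_isConformalMap hd (conformalAt_iff_isConformalMap_fderiv.1
    (S.initialMap_conformalAt n ω x (hAV hx))), ENNReal.ofReal_pow (norm_nonneg _), ofReal_norm,
    ← mul_pow]
  gcongr
  exact hK.wordNorm_le n ω (hAV hx)

/-- Every point of `X` has a ball of uniform radius contained in `V`. -/
theorem exists_ball_subset_V (hc : IsCompact X) : ∃ δ > 0, ∀ p ∈ X, Metric.ball p δ ⊆ S.V := by
  obtain ⟨δ, hδ, h⟩ := hc.exists_thickening_subset_open S.isOpen_V S.subset_V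
  exact ⟨δ, hδ, fun p hp => (Metric.ball_subset_thickening hp δ).trans h⟩

variable {S} in
-- The mean value inequality needs a convex domain. `X` need not be convex, so the estimate is made
-- on balls inside `V`, where distortion controls the derivative off `X` as well.
theorem IsDistortion.dist_le {K : ℝ≥0} (hK : S.IsDistortion K) (hne : X.Nonempty) (n : ℕ)
    (ω : Word S.index 0 n) {p x y : E d} {δ : ℝ} (hδ : Metric.ball p δ ⊆ S.V)
    (hx : x ∈ Metric.ball p δ) (hy : y ∈ Metric.ball p δ) :
    dist (S.initialMap n ω x) (S.initialMap n ω y) ≤ K * (S.wordNorm n ω).toReal * dist x y := by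
  rw [dist_eq_norm, dist_eq_norm]
  refine (convex_ball p δ).norm_image_sub_le_of_norm_fderiv_le (𝕜 := ℝ)
    (fun z hz => (S.initialMap_conformalAt n ω z (hδ hz)).differentiableAt) (fun z hz => ?_) hy hx
  have h := hK.wordDeriv_le n ω (hδ hz) hne
  have h2 := ENNReal.toReal_mono
    (ENNReal.mul_ne_top ENNReal.coe_ne_top (S.wordNorm_ne_top hne n ω)) h
  rw [wordDeriv, toReal_enorm, ENNReal.toReal_mul, ENNReal.coe_toReal] at h2
  exact h2

/-- Each such word maps a corkscrew to a set of volume at least a constant times `r ^ d` inside a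
ball of radius comparable to `r`. At a fixed level these sets are disjoint, so comparing volumes
bounds their number. -/
theorem exists_card_le (hd : 0 < d) (hX : IsPhaseSpace X) :
    ∃ N₀ : ℝ≥0, ∀ (n : ℕ) (r : ℝ) (x : E d) (T : Finset (Word S.index 0 n)), 0 < r →
      (∀ ω ∈ T, ENNReal.ofReal r < S.wordNorm n ω ∧
        (S.initialMap n ω '' X ∩ Metric.ball x r).Nonempty) → (T.card : ℝ≥0∞) ≤ N₀ := by
  have := nontrivial_E hd
  obtain ⟨K, hK⟩ := S.exists_isDistortion
  obtain ⟨κ, s₀, hκ, hs₀, hcork⟩ := hX.hasCorkscrews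
  obtain ⟨δ, hδ, hδV⟩ := S.exists_ball_subset_V hX.isCompact
  set s₁ := min s₀ δ with hs₁
  have hs₁0 : 0 < s₁ := lt_min hs₀ hδ
  set v₁ := volume (Metric.ball (0 : E d) 1) with hv₁
  have hv0 : v₁ ≠ 0 := (Metric.measure_ball_pos _ _ one_pos).ne'
  have hvt : v₁ ≠ ⊤ := measure_ball_lt_top.ne
  set R : ℝ := 1 + K * s₁ with hR
  have hR0 : 0 < R := by positivity
  have hfr : Module.finrank ℝ (E d) = d := finrank_euclideanSpace_fin
  -- The constant is the volume `(R r)^d` of the enclosing ball divided by the lower bound `(κ s₁ r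
  -- / K)^d` for one image, up to the common volume of the unit ball.
  refine ⟨(((K : ℝ) * R / (κ * s₁)) ^ d).toNNReal, fun n r x T hr hT => ?_⟩
  have hstep : ∀ ω ∈ T, ∃ y, Metric.ball y (κ * (s₁ * r / (S.wordNorm n ω).toReal)) ⊆ interior X ∧
      S.initialMap n ω '' Metric.ball y (κ * (s₁ * r / (S.wordNorm n ω).toReal)) ⊆
        Metric.ball x (R * r) := by
    intro ω hω
    obtain ⟨hL, _, ⟨p, hp, rfl⟩, hpx⟩ := hT ω hω
    set ℓ := (S.wordNorm n ω).toReal with hℓ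
    have hrℓ : r < ℓ := (ENNReal.ofReal_lt_iff_lt_toReal hr.le (S.wordNorm_ne_top hX.nonempty n ω)).1 hL
    have hℓ0 : 0 < ℓ := hr.trans hrℓ
    have hsl : s₁ * r / ℓ ≤ s₁ := by
      rw [div_le_iff₀ hℓ0]; exact mul_le_mul_of_nonneg_left hrℓ.le hs₁0.le
    -- The scale `s₁ r / ℓ` is what the map, of size `ℓ > r`, magnifies to about `r`; being at most
    -- `s₁`, it is admissible for both the corkscrews and the balls in `V`.
    obtain ⟨y, hy⟩ := hcork p hp (s₁ * r / ℓ) (by positivity) (hsl.trans (min_le_left _ _))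
    refine ⟨y, hy.trans inter_subset_left, ?_⟩
    rintro _ ⟨z, hz, rfl⟩
    have hzp : dist z p < s₁ * r / ℓ := (hy hz).2
    have h1 := hK.dist_le hX.nonempty n ω (hδV p hp) (x := z) (y := p)
      (hzp.trans_le (hsl.trans (min_le_right _ _))) (Metric.mem_ball_self hδ)
    have h2 : K * ℓ * dist z p ≤ K * s₁ * r := by
      calc K * ℓ * dist z p ≤ K * ℓ * (s₁ * r / ℓ) := by gcongr
        _ = K * s₁ * r := by field_simp
    rw [Metric.mem_ball] at hpx ⊢
    have h3 := dist_triangle (S.initialMap n ω z) (S.initialMap n ω p) x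
    have h4 : R * r = r + K * s₁ * r := by rw [hR]; ring
    linarith
  choose! y hy1 hy2 using hstep
  set B : Word S.index 0 n → Set (E d) := fun ω =>
    Metric.ball (y ω) (κ * (s₁ * r / (S.wordNorm n ω).toReal)) with hB
  have hBV : ∀ ω ∈ T, B ω ⊆ S.V := fun ω hω =>
    (hy1 ω hω).trans (interior_subset.trans S.subset_V)
  have hvol : ∀ ω ∈ T, ENNReal.ofReal ((κ * s₁ * r) ^ d) * v₁ ≤
      (K : ℝ≥0∞) ^ d * volume (S.initialMap n ω '' B ω) := by
    intro ω hω
    refine le_trans (le_of_eq ?_)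
      (hK.volume_image hd n ω Metric.isOpen_ball.measurableSet (hBV ω hω))
    have hLt := S.wordNorm_ne_top hX.nonempty n ω
    have hℓ0 : 0 < (S.wordNorm n ω).toReal :=
      ENNReal.toReal_pos (S.wordNorm_ne_zero hd hX.nonempty n ω) hLt
    rw [hB, Measure.addHaar_ball _ _ (by positivity), hfr, ← mul_assoc]
    congr 1
    nth_rewrite 1 [← ENNReal.ofReal_toReal hLt]
    rw [← ENNReal.ofReal_pow hℓ0.le, ← ENNReal.ofReal_mul (by positivity), ← mul_pow]
    congr 2
    field_simp
  have hsum : ∑ ω ∈ T, volume (S.initialMap n ω '' B ω) ≤ ENNReal.ofReal ((R * r) ^ d) * v₁ := by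
    rw [← measure_biUnion_finset]
    · calc _ ≤ volume (Metric.ball x (R * r)) := measure_mono (iUnion₂_subset hy2)
        _ = _ := by rw [Measure.addHaar_ball _ _ (by positivity), hfr]
    · intro ω hω ω' hω' hne
      exact (S.disjoint_initialMap_image n ω ω' hne).mono (image_mono (hy1 ω hω))
        (image_mono (hy1 ω' hω'))
    · exact fun ω hω =>
        S.measurableSet_initialMap_image n ω Metric.isOpen_ball.measurableSet (hBV ω hω)
  have hmain : (T.card : ℝ≥0∞) * (ENNReal.ofReal ((κ * s₁ * r) ^ d) * v₁) ≤
      (K : ℝ≥0∞) ^ d * (ENNReal.ofReal ((R * r) ^ d) * v₁) := by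
    calc _ = ∑ ω ∈ T, ENNReal.ofReal ((κ * s₁ * r) ^ d) * v₁ := by
          rw [Finset.sum_const, nsmul_eq_mul]
      _ ≤ ∑ ω ∈ T, (K : ℝ≥0∞) ^ d * volume (S.initialMap n ω '' B ω) := Finset.sum_le_sum hvol
      _ = (K : ℝ≥0∞) ^ d * ∑ ω ∈ T, volume (S.initialMap n ω '' B ω) := by rw [Finset.mul_sum]
      _ ≤ _ := by gcongr
  rw [← mul_assoc, ← mul_assoc, ENNReal.mul_le_mul_iff_left hv0 hvt] at hmain
  have hpos : 0 < (κ * s₁ * r) ^ d := by positivity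
  have hKof : (K : ℝ≥0∞) ^ d = ENNReal.ofReal ((K : ℝ) ^ d) := by
    rw [ENNReal.ofReal_pow K.coe_nonneg, ENNReal.ofReal_coe_nnreal]
  rw [hKof, ← ENNReal.ofReal_mul (by positivity), ← ENNReal.le_div_iff_mul_le
    (Or.inl (by simpa using hpos)) (Or.inl ENNReal.ofReal_ne_top),
    ← ENNReal.ofReal_div_of_pos hpos] at hmain
  refine hmain.trans (le_of_eq ?_)
  rw [← ENNReal.ofReal]
  congr 1
  rw [← mul_pow, ← div_pow]
  congr 1
  field_simp

/-- The images of the interior are disjoint subsets of `X`, and each has volume comparable from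
below to the `d`-th power of its norm. -/
theorem exists_Z_dim_le (hd : 0 < d) (hX : IsPhaseSpace X) : ∃ C : ℝ≥0, ∀ n, S.Z n d ≤ C := by
  obtain ⟨K, hK⟩ := S.exists_isDistortion
  have hv0 : volume (interior X) ≠ 0 := by
    refine (isOpen_interior.measure_pos volume ?_).ne'
    rw [← closure_nonempty_iff, hX.closure_interior]
    exact hX.nonempty
  have hvX : volume X ≠ ⊤ := hX.isCompact.measure_lt_top.ne
  have hvt : volume (interior X) ≠ ⊤ := ne_top_of_le_ne_top hvX (measure_mono interior_subset)
  have hint : interior X ⊆ S.V := interior_subset.trans S.subset_V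
  have hfin : (K : ℝ≥0∞) ^ d * volume X / volume (interior X) ≠ ⊤ :=
    ENNReal.div_ne_top (ENNReal.mul_ne_top (ENNReal.pow_ne_top ENNReal.coe_ne_top) hvX) hv0
  refine ⟨((K : ℝ≥0∞) ^ d * volume X / volume (interior X)).toNNReal, fun n => ?_⟩
  rw [ENNReal.coe_toNNReal hfin, ENNReal.le_div_iff_mul_le (Or.inl hv0) (Or.inl hvt), Z,
    ← ENNReal.tsum_mul_right]
  have hmeas : ∀ ω, MeasurableSet (S.initialMap n ω '' interior X) := fun ω =>
    S.measurableSet_initialMap_image n ω isOpen_interior.measurableSet hint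
  calc _ ≤ ∑' ω : Word S.index 0 n, (K : ℝ≥0∞) ^ d * volume (S.initialMap n ω '' interior X) := by
        refine ENNReal.tsum_le_tsum fun ω => ?_
        rw [ENNReal.rpow_natCast]
        exact hK.volume_image hd n ω isOpen_interior.measurableSet hint
    _ = (K : ℝ≥0∞) ^ d * volume (⋃ ω, S.initialMap n ω '' interior X) := by
        rw [ENNReal.tsum_mul_left, measure_iUnion (S.disjoint_initialMap_image n) hmeas]
    _ ≤ _ := by
        gcongr
        exact iUnion_subset fun ω =>
          (image_mono interior_subset).trans (S.initialMap_mapsTo_X n ω).image_subset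

/-! ### Pressure and the upper bound for the dimension. -/

theorem exp_le_iff_le_log_div {a : ℝ} {n : ℕ} (hn : 0 < n) {z : ℝ≥0∞} :
    ENNReal.ofReal (Real.exp (a * n)) ≤ z ↔ (a : EReal) ≤ ENNReal.log z / (n : EReal) := by
  rw [EReal.le_div_iff_mul_le (by exact_mod_cast hn) (EReal.natCast_ne_top n),
    ← EReal.exp_coe, ← ENNReal.exp_log z, EReal.exp_le_exp_iff, EReal.log_exp]
  push_cast
  rfl

theorem lowerPressure_pos_iff (t : ℝ) : 0 < S.lowerPressure t ↔
    ∃ a : ℝ, 0 < a ∧ ∀ᶠ n : ℕ in atTop, ENNReal.ofReal (Real.exp (a * n)) ≤ S.Z n t := by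
  constructor
  · intro h
    obtain ⟨a, ha0, ha⟩ := EReal.lt_iff_exists_real_btwn.1 h
    refine ⟨a, by exact_mod_cast ha0, ?_⟩
    filter_upwards [eventually_lt_of_lt_liminf ha, eventually_gt_atTop 0] with n hn hn0
    exact (exp_le_iff_le_log_div hn0).2 hn.le
  · rintro ⟨a, ha0, ha⟩
    refine lt_of_lt_of_le (b := (a : EReal)) (by exact_mod_cast ha0) ?_
    refine le_liminf_of_le (by isBoundedDefault) ?_
    filter_upwards [ha, eventually_gt_atTop 0] with n hn hn0
    exact (exp_le_iff_le_log_div hn0).1 hn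

theorem eventually_wordNorm_le_one : ∀ᶠ n : ℕ in atTop, ∀ ω : Word S.index 0 n,
    S.wordNorm n ω ≤ 1 := by
  obtain ⟨η, h0, h1, N, h⟩ := S.exists_wordNorm_le
  filter_upwards [eventually_ge_atTop (N + 1)] with n hn ω
  obtain ⟨m, rfl⟩ : ∃ m, n = m + 1 := ⟨n - 1, by omega⟩
  refine (h m (by omega) ω).trans ?_
  rw [← ENNReal.ofReal_one]
  exact ENNReal.ofReal_le_ofReal (pow_le_one₀ h0.le h1.le)

/-- For `t ≥ d` and norms at most 1, `Z n t ≤ Z n d` is bounded, which excludes exponential growth.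
This confines the lower bound to exponents below `d`, where the class conditions apply. -/
theorem lt_dim_of_lowerPressure_pos (hd : 0 < d) (hX : IsPhaseSpace X) {t : ℝ}
    (ht : 0 < S.lowerPressure t) : t < d := by
  by_contra! hdt
  obtain ⟨a, ha0, ha⟩ := (S.lowerPressure_pos_iff t).1 ht
  obtain ⟨C, hC⟩ := S.exists_Z_dim_le hd hX
  have hlim : Tendsto (fun n : ℕ => Real.exp (a * n)) atTop atTop :=
    Real.tendsto_exp_atTop.comp (tendsto_natCast_atTop_atTop.const_mul_atTop ha0)
  obtain ⟨n, h1, h2, h3⟩ := (ha.and (S.eventually_wordNorm_le_one.and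
    (hlim.eventually_gt_atTop (C : ℝ)))).exists
  have h4 : S.Z n t ≤ S.Z n d := ENNReal.tsum_le_tsum fun ω =>
    ENNReal.rpow_le_rpow_of_exponent_ge (h2 ω) hdt
  have h5 := (h1.trans h4).trans (hC n)
  rw [← ENNReal.ofReal_coe_nnreal, ENNReal.ofReal_le_ofReal_iff C.coe_nonneg] at h5
  linarith

theorem limitSet_subset (n : ℕ) (hn : 0 < n) :
    S.limitSet ⊆ ⋃ ω : Word S.index 0 n, S.initialMap n ω '' X := by
  obtain ⟨m, rfl⟩ : ∃ m, n = m + 1 := ⟨n - 1, by omega⟩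
  exact iInter_subset _ m

theorem ediam_image_le {K : ℝ≥0} (hK : S.IsDistortion K) (hne : X.Nonempty) (n : ℕ)
    (ω : Word S.index 0 n) {p : E d} {δ : ℝ} (hδ : Metric.ball p δ ⊆ S.V) (A : Set (E d))
    (hA : A ⊆ Metric.ball p δ) :
    Metric.ediam (S.initialMap n ω '' A) ≤ K * ENNReal.ofReal (2 * δ) * S.wordNorm n ω := by
  refine Metric.ediam_le ?_
  rintro _ ⟨x, hx, rfl⟩ _ ⟨y, hy, rfl⟩
  have h := hK.dist_le hne n ω hδ (hA hx) (hA hy)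
  have hxy : dist x y ≤ 2 * δ := by
    have h1 : dist x p < δ := hA hx
    have h2 : dist y p < δ := hA hy
    linarith [dist_triangle_right x y p]
  have h2 : dist (S.initialMap n ω x) (S.initialMap n ω y) ≤
      K * (2 * δ) * (S.wordNorm n ω).toReal := by
    refine h.trans ?_
    calc _ ≤ K * (S.wordNorm n ω).toReal * (2 * δ) := by gcongr
      _ = _ := by ring
  have hδ0 : 0 ≤ 2 * δ := dist_nonneg.trans hxy
  rw [edist_dist]
  refine (ENNReal.ofReal_le_ofReal h2).trans (le_of_eq ?_)
  rw [ENNReal.ofReal_mul (by positivity), ENNReal.ofReal_mul K.coe_nonneg,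
    ENNReal.ofReal_coe_nnreal, ENNReal.ofReal_toReal (S.wordNorm_ne_top hne n ω)]

theorem frequently_Z_le {t₁ t : ℝ} (ht₁0 : 0 ≤ t₁) (h : t₁ < t) (ht₁ : ¬ 0 < S.lowerPressure t₁) :
    ∃ C : ℝ≥0∞, C ≠ ⊤ ∧ ∃ᶠ n : ℕ in atTop, S.Z n t ≤ C := by
  obtain ⟨η, h0, h1, N, hη⟩ := S.exists_wordNorm_le
  set s := t - t₁ with hs
  have hs0 : 0 < s := sub_pos.2 h
  -- The rate at which `η ^ m` to the power `s` decays. Growth of `Z` at `t₁` slower than `exp (a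
  -- n)` for infinitely many `n` is cancelled exactly; the shift `n = m + 1` leaves the constant
  -- `exp a`.
  set a : ℝ := s * (-Real.log η) with ha
  have ha0 : 0 < a := mul_pos hs0 (neg_pos.2 (Real.log_neg h0 h1))
  refine ⟨ENNReal.ofReal (Real.exp a), ENNReal.ofReal_ne_top, ?_⟩
  rw [lowerPressure_pos_iff] at ht₁
  push Not at ht₁
  refine ((ht₁ a ha0).and_eventually (eventually_ge_atTop (N + 1))).mono ?_
  rintro n ⟨hn, hnN⟩
  obtain ⟨m, rfl⟩ : ∃ m, n = m + 1 := ⟨n - 1, by omega⟩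
  have hstep : S.Z (m + 1) t ≤ ENNReal.ofReal (η ^ m) ^ s * S.Z (m + 1) t₁ := by
    rw [Z, Z, ← ENNReal.tsum_mul_left]
    refine ENNReal.tsum_le_tsum fun ω => ?_
    have hle : S.wordNorm (m + 1) ω ≤ ENNReal.ofReal (η ^ m) := hη m (by omega) ω
    change S.wordNorm (m + 1) ω ^ t ≤ _ * S.wordNorm (m + 1) ω ^ t₁
    by_cases hw : S.wordNorm (m + 1) ω = 0
    · rw [hw, ENNReal.zero_rpow_of_pos (ht₁0.trans_lt h)]
      exact zero_le
    · have hwt : S.wordNorm (m + 1) ω ≠ ⊤ := ne_top_of_le_ne_top ENNReal.ofReal_ne_top hle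
      have : t = s + t₁ := by rw [hs]; ring
      rw [this, ENNReal.rpow_add _ _ hw hwt]
      gcongr
  refine hstep.trans ?_
  calc ENNReal.ofReal (η ^ m) ^ s * S.Z (m + 1) t₁
      ≤ ENNReal.ofReal (η ^ m) ^ s * ENNReal.ofReal (Real.exp (a * (m + 1 : ℕ))) := by gcongr
    _ = ENNReal.ofReal (Real.exp a) := by
        rw [ENNReal.ofReal_rpow_of_nonneg (by positivity) hs0.le,
          ← ENNReal.ofReal_mul (by positivity), Real.rpow_def_of_pos (by positivity),
          ← Real.exp_add, Real.log_pow]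
        congr 2
        rw [ha]
        push_cast
        ring

theorem dimH_limitSet_le (hX : IsPhaseSpace X) : dimH S.limitSet ≤ S.bowenDim := by
  by_contra! hlt
  obtain ⟨t₁, hBt₁, ht₁⟩ := ENNReal.lt_iff_exists_nnreal_btwn.1 hlt
  obtain ⟨t, ht₁t, ht⟩ := ENNReal.lt_iff_exists_nnreal_btwn.1 ht₁
  have ht₁t' : (t₁ : ℝ) < t := by exact_mod_cast ht₁t
  have hP : ¬ 0 < S.lowerPressure t₁ := fun hpos =>
    absurd (le_iSup₂ (f := fun (t : ℝ≥0) (_ : 0 < S.lowerPressure t) => (t : ℝ≥0∞)) t₁ hpos)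
      (not_le.2 hBt₁)
  obtain ⟨C, hC, hfreq⟩ := S.frequently_Z_le t₁.coe_nonneg ht₁t' hP
  obtain ⟨K, hK⟩ := S.exists_isDistortion
  obtain ⟨δ, hδ, hδV⟩ := S.exists_ball_subset_V hX.isCompact
  obtain ⟨T, hTX, hTc⟩ := hX.isCompact.elim_nhds_subcover (fun p => Metric.ball p δ)
    (fun p _ => Metric.ball_mem_nhds p hδ)
  obtain ⟨η, h0, h1, N, hη⟩ := S.exists_wordNorm_le
  set D : ℝ≥0∞ := K * ENNReal.ofReal (2 * δ) with hD
  have hDt : D ≠ ⊤ := ENNReal.mul_ne_top ENNReal.coe_ne_top ENNReal.ofReal_ne_top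
  -- Only the levels with bounded `Z` are useful for covering, so the limit is taken along them.
  set l : Filter ℕ := atTop ⊓ 𝓟 {n | S.Z n t ≤ C} with hl
  have : l.NeBot := frequently_iff_neBot.1 hfreq
  have hllt : l ≤ atTop := inf_le_left
  set r : ℕ → ℝ≥0∞ := fun n => D * ENNReal.ofReal (η ^ (n - 1)) with hr
  have hr0 : Tendsto r atTop (𝓝 0) := by
    have h2 : Tendsto (fun n : ℕ => η ^ (n - 1)) atTop (𝓝 0) :=
      (tendsto_pow_atTop_nhds_zero_of_lt_one h0.le h1).comp (tendsto_sub_atTop_nat 1)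
    have h3 := ENNReal.tendsto_ofReal h2
    rw [ENNReal.ofReal_zero] at h3
    have h4 := ENNReal.Tendsto.const_mul (a := D) h3 (Or.inr hDt)
    simpa using h4
  -- The images of `X` are cut along a finite cover by balls inside `V`, because diameters are
  -- controlled by norms only on such balls. This costs the fixed factor `T.card`.
  let cov : (n : ℕ) → (Word S.index 0 n × T) → Set (E d) := fun n q =>
    S.initialMap n q.1 '' (X ∩ Metric.ball q.2 δ)
  have hcd : ∀ n q, Metric.ediam (cov n q) ≤ D * S.wordNorm n q.1 := fun n q =>
    S.ediam_image_le hK hX.nonempty n q.1 (hδV q.2 (hTX q.2 q.2.2)) _ inter_subset_right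
  have key := Measure.hausdorffMeasure_le_liminf_tsum (t : ℝ) S.limitSet (l := l) r
    (hr0.mono_left hllt) cov ?_ ?_
  · have hle : μH[(t : ℝ)] S.limitSet ≤ D ^ (t : ℝ) * C * T.card := by
      refine key.trans (liminf_le_of_frequently_le' (Eventually.frequently ?_))
      have hmem : {n | S.Z n t ≤ C} ∈ l := mem_inf_of_right (mem_principal_self _)
      filter_upwards [hmem] with n hn
      have hn' : ∑' ω : Word S.index 0 n, S.wordNorm n ω ^ (t : ℝ) ≤ C := hn
      calc ∑' q : Word S.index 0 n × T, Metric.ediam (cov n q) ^ (t : ℝ)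
          ≤ ∑' q : Word S.index 0 n × T, (D * S.wordNorm n q.1) ^ (t : ℝ) :=
            ENNReal.tsum_le_tsum fun q => ENNReal.rpow_le_rpow (hcd n q) t.coe_nonneg
        _ = ∑' ω : Word S.index 0 n, ∑' p : T, D ^ (t : ℝ) * S.wordNorm n ω ^ (t : ℝ) := by
            rw [ENNReal.tsum_prod']
            simp_rw [ENNReal.mul_rpow_of_nonneg _ _ t.coe_nonneg]
        _ = ∑' ω : Word S.index 0 n, D ^ (t : ℝ) * S.wordNorm n ω ^ (t : ℝ) * T.card := by
            refine tsum_congr fun ω => ?_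
            rw [ENNReal.tsum_const, mul_comm]
            simp
        _ = D ^ (t : ℝ) * (∑' ω : Word S.index 0 n, S.wordNorm n ω ^ (t : ℝ)) * T.card := by
            rw [ENNReal.tsum_mul_right, ENNReal.tsum_mul_left]
        _ ≤ _ := by gcongr
    have hfin : μH[(t : ℝ)] S.limitSet ≠ ⊤ := ne_top_of_le_ne_top
      (ENNReal.mul_ne_top (ENNReal.mul_ne_top
        (ENNReal.rpow_ne_top_of_nonneg t.coe_nonneg hDt) hC) (ENNReal.natCast_ne_top _)) hle
    exact absurd (dimH_le_of_hausdorffMeasure_ne_top hfin) (not_le.2 ht)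
  · refine hllt ?_
    filter_upwards [eventually_ge_atTop (N + 1)] with n hn q
    obtain ⟨m, rfl⟩ : ∃ m, n = m + 1 := ⟨n - 1, by omega⟩
    refine (hcd _ q).trans ?_
    simp only [hr, add_tsub_cancel_right]
    gcongr
    exact hη m (by omega) q.1
  · refine hllt ?_
    filter_upwards [eventually_gt_atTop 0] with n hn x hx
    obtain ⟨ω, y, hy, rfl⟩ := mem_iUnion.1 (S.limitSet_subset n hn hx)
    obtain ⟨p, hp, hyp⟩ := mem_iUnion₂.1 (hTc hy)
    exact mem_iUnion.2 ⟨(ω, ⟨p, hp⟩), y, ⟨hy, hyp⟩, rfl⟩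

end NCIFS

/-! ### Covers by open balls, and elementary counting sums. -/

/-- An open ball around a point of a set of diameter `D` contains the set if its radius exceeds `D`.
Continuity of the power makes the extra cost at most `e`, also when `D = 0`. -/
theorem exists_radius {D e : ℝ≥0∞} {t : ℝ} (ht : 0 < t) (hD : D < 1) (he : e ≠ 0) :
    ∃ r : ℝ, 0 < r ∧ r < 1 ∧ D < ENNReal.ofReal r ∧ ENNReal.ofReal r ^ t ≤ D ^ t + e := by
  have hDt : D ≠ ⊤ := (hD.trans ENNReal.one_lt_top).ne
  have hlt : D ^ t < D ^ t + e :=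
    ENNReal.lt_add_right (ENNReal.rpow_ne_top_of_nonneg ht.le hDt) he
  have h1 : ∀ᶠ x in 𝓝[>] D, x ^ t < D ^ t + e :=
    (ENNReal.continuous_rpow_const.continuousAt.eventually_lt_const hlt).filter_mono
      nhdsWithin_le_nhds
  have h2 : ∀ᶠ x in 𝓝[>] D, x < 1 := (eventually_lt_nhds hD).filter_mono nhdsWithin_le_nhds
  have : (𝓝[>] D).NeBot := nhdsGT_neBot_of_exists_gt ⟨1, hD⟩
  obtain ⟨x, hx1, hx2, hx3⟩ := (h1.and (h2.and self_mem_nhdsWithin)).exists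
  have hxt : x ≠ ⊤ := (hx2.trans ENNReal.one_lt_top).ne
  have hx0 : x ≠ 0 := ((zero_le (a := D)).trans_lt hx3).ne'
  refine ⟨x.toReal, ENNReal.toReal_pos hx0 hxt, ?_, ?_, ?_⟩
  · rw [← ENNReal.toReal_one]
    exact (ENNReal.toReal_lt_toReal hxt ENNReal.one_ne_top).2 hx2
  · rw [ENNReal.ofReal_toReal hxt]; exact hx3
  · rw [ENNReal.ofReal_toReal hxt]; exact hx1.le

/-- A set of Hausdorff measure zero has countable covers by small balls of small total size. -/
theorem exists_ball_cover {Y : Type*} [MetricSpace Y] [MeasurableSpace Y] [BorelSpace Y]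
    [Nonempty Y] {s : Set Y} {t : ℝ} (ht : 0 < t) (hs : μH[t] s = 0) {ε : ℝ≥0∞} (hε : ε ≠ 0) :
    ∃ (c : ℕ → Y) (r : ℕ → ℝ), (∀ i, 0 < r i ∧ r i < 1) ∧ s ⊆ ⋃ i, Metric.ball (c i) (r i) ∧
      ∑' i, ENNReal.ofReal (r i) ^ t ≤ ε := by
  have hε2 : ε / 2 ≠ 0 := (ENNReal.half_pos hε).ne'
  obtain ⟨e, he0, hesum⟩ := ENNReal.exists_pos_sum_of_countable' hε2 ℕ
  rw [Measure.hausdorffMeasure_apply] at hs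
  -- Pieces of diameter at most `1 / 2` leave room for radii below 1; then the empty word, of norm
  -- 1, is larger than every ball.
  have hs2 := ENNReal.iSup_eq_zero.1 (ENNReal.iSup_eq_zero.1 hs (1 / 2)) (by simp)
  have hlt := hs2.trans_lt (pos_iff_ne_zero.2 hε2)
  simp only [iInf_lt_iff] at hlt
  obtain ⟨u, hsu, hud, hsum⟩ := hlt
  have hex : ∀ i, ∃ (c : Y) (r : ℝ), (0 < r ∧ r < 1) ∧ u i ⊆ Metric.ball c r ∧
      ENNReal.ofReal r ^ t ≤ (⨆ _ : (u i).Nonempty, Metric.ediam (u i) ^ t) + e i := by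
    intro i
    rcases (u i).eq_empty_or_nonempty with hemp | hne
    · obtain ⟨r, h0, h1, -, h3⟩ := exists_radius (D := 0) ht one_pos (he0 i).ne'
      refine ⟨Classical.arbitrary Y, r, ⟨h0, h1⟩, by simp [hemp], ?_⟩
      rw [ENNReal.zero_rpow_of_pos ht, zero_add] at h3
      exact h3.trans le_add_self
    · have hD : Metric.ediam (u i) < 1 := (hud i).trans_lt (by
        rw [one_div]; exact ENNReal.one_half_lt_one)
      obtain ⟨r, h0, h1, h2, h3⟩ := exists_radius (D := Metric.ediam (u i)) ht hD (he0 i).ne'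
      obtain ⟨c, hc⟩ := hne
      refine ⟨c, r, ⟨h0, h1⟩, fun y hy => ?_, ?_⟩
      · have h4 := (Metric.edist_le_ediam_of_mem hy hc).trans_lt h2
        rw [edist_dist, ENNReal.ofReal_lt_ofReal_iff h0] at h4
        exact h4
      · rw [iSup_pos ⟨c, hc⟩]; exact h3
  choose c r hr hur hrt using hex
  refine ⟨c, r, hr, hsu.trans (iUnion_mono hur), ?_⟩
  calc _ ≤ ∑' i, ((⨆ _ : (u i).Nonempty, Metric.ediam (u i) ^ t) + e i) :=
        ENNReal.tsum_le_tsum hrt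
    _ = _ + ∑' i, e i := ENNReal.tsum_add
    _ ≤ ε / 2 + ε / 2 := add_le_add hsum.le hesum.le
    _ = ε := ENNReal.add_halves ε

theorem tsum_indicator_le_card {ι : Type*} {G : Set ι} {N : ℝ≥0∞}
    (h : ∀ T : Finset ι, (∀ ω ∈ T, ω ∈ G) → (T.card : ℝ≥0∞) ≤ N) (c : ℝ≥0∞) :
    ∑' ω, G.indicator (fun _ => c) ω ≤ N * c := by
  classical
  rw [ENNReal.tsum_eq_iSup_sum]
  refine iSup_le fun T => ?_
  rw [Finset.sum_indicator_eq_sum_filter, Finset.sum_const, nsmul_eq_mul]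
  gcongr
  exact h _ fun ω hω => (Finset.mem_filter.1 hω).2

theorem tsum_subtype_finset_le {I : Set ℕ} (F : Finset ℕ) (c : ℝ≥0∞) :
    ∑' a : I, {a : I | (a : ℕ) ∈ F}.indicator (fun _ => c) a ≤ F.card * c := by
  refine tsum_indicator_le_card (fun T hT => ?_) c
  have : (T.map (Function.Embedding.subtype _)).card ≤ F.card := Finset.card_le_card fun k hk => by
    obtain ⟨a, ha, rfl⟩ := Finset.mem_map.1 hk
    exact hT a ha
  rw [Finset.card_map] at this
  exact_mod_cast this

/-! ### Weights of restricted words and the mass distribution argument. -/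

namespace NCIFS

variable {d : ℕ} {X : Set (E d)} (S : NCIFS X)

/-- The words all of whose letters belong to the restricted alphabets `F`. -/
def admissible (F : ℕ → Set ℕ) (n : ℕ) : Set (Word S.index 0 n) :=
  {ω | ∀ j : Fin n, (ω j : ℕ) ∈ F j}

theorem mem_admissible_succ {F : ℕ → Set ℕ} {n : ℕ} {ω : Word S.index 0 (n + 1)} :
    ω ∈ S.admissible F (n + 1) ↔
      wordInit ω ∈ S.admissible F n ∧ (wordLast ω : ℕ) ∈ F n := by
  constructor
  · intro h
    exact ⟨fun j => h j.castSucc, h (Fin.last n)⟩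
  · rintro ⟨h1, h2⟩ j
    refine Fin.lastCases ?_ (fun i => ?_) j
    · exact h2
    · exact h1 i

theorem admissible_univ (n : ℕ) : S.admissible (fun _ => univ) n = univ :=
  eq_univ_of_forall fun _ _ => mem_univ _

theorem admissible_zero (F : ℕ → Set ℕ) : S.admissible F 0 = univ :=
  eq_univ_of_forall fun _ j => j.elim0

theorem finite_admissible (F : ℕ → Finset ℕ) (n : ℕ) :
    (S.admissible (fun n => F n) n).Finite := by
  have h : {f : Fin n → ℕ | ∀ j : Fin n, f j ∈ (F j : Set ℕ)}.Finite :=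
    Set.Finite.pi' fun j => (F j).finite_toSet
  refine h.preimage (f := fun ω : Word S.index 0 n => fun j => (ω j : ℕ)) ?_
  intro ω _ ω' _ hww
  funext j
  exact Subtype.ext (congrFun hww j)

/-- The sum of `|Dφ_ω(x)|^t` over a set of words. -/
noncomputable def wordSum {n : ℕ} (A : Set (Word S.index 0 n)) (t : ℝ) (x : E d) : ℝ≥0∞ :=
  ∑' ω, A.indicator (fun ω => S.wordDeriv n ω x ^ t) ω

theorem wordSum_mono {n : ℕ} {A B : Set (Word S.index 0 n)} (h : A ⊆ B) (t : ℝ) (x : E d) :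
    S.wordSum A t x ≤ S.wordSum B t x :=
  ENNReal.tsum_le_tsum fun ω => indicator_le_indicator_of_subset h (fun _ => zero_le) ω

theorem wordSum_biUnion_le {n : ℕ} {ι : Type*} (s : Finset ι) (A : ι → Set (Word S.index 0 n))
    (t : ℝ) (x : E d) : S.wordSum (⋃ i ∈ s, A i) t x ≤ ∑ i ∈ s, S.wordSum (A i) t x := by
  simp only [wordSum]
  rw [← Summable.tsum_finsetSum fun _ _ => ENNReal.summable]
  refine ENNReal.tsum_le_tsum fun ω => indicator_apply_le' (fun hω => ?_) (fun _ => zero_le)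
  obtain ⟨i, hi, hω⟩ := mem_iUnion₂.1 hω
  refine le_trans (le_of_eq ?_)
    (Finset.single_le_sum (f := fun i => (A i).indicator (fun ω => S.wordDeriv n ω x ^ t) ω)
      (fun _ _ => zero_le) hi)
  simp only [indicator_of_mem hω]

theorem wordSum_union_le {n : ℕ} (A B : Set (Word S.index 0 n)) (t : ℝ) (x : E d) :
    S.wordSum (A ∪ B) t x ≤ S.wordSum A t x + S.wordSum B t x := by
  simp only [wordSum]
  rw [← ENNReal.tsum_add]
  refine ENNReal.tsum_le_tsum fun ω => indicator_apply_le' (fun hω => ?_) (fun _ => zero_le)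
  rcases hω with h | h
  · simp only [indicator_of_mem h]; exact le_self_add
  · simp only [indicator_of_mem h]; exact le_add_self

theorem wordSum_zero (hd : 0 < d) {A : Set (Word S.index 0 0)} (hA : A = univ) (t : ℝ) (x : E d) :
    S.wordSum A t x = 1 := by
  have : Unique (Word S.index 0 0) := Pi.uniqueOfIsEmpty _
  rw [wordSum, hA, tsum_eq_single default (fun b hb => (hb (Subsingleton.elim _ _)).elim),
    indicator_univ, S.wordDeriv_zero hd, ENNReal.one_rpow]

/-- The last letter acts first on the point, so splitting it off writes the sum as a positive
transfer operator applied to the sums of one level less. Later inductions over all `x ∈ X` rest on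
this. -/
theorem wordSum_succ (hd : 0 < d) {n : ℕ} (A : Set (Word S.index 0 (n + 1))) {t : ℝ} (ht : 0 ≤ t)
    {x : E d} (hx : x ∈ S.V) : S.wordSum A t x = ∑' a : S.index (0 + n),
      S.letterDeriv (0 + n) a x ^ t *
        S.wordSum {ω | wordEquiv S.index n (a, ω) ∈ A} t (S.map (0 + n) a x) := by
  simp only [wordSum]
  rw [tsum_word_succ]
  refine tsum_congr fun a => ?_
  rw [← ENNReal.tsum_mul_left]
  refine tsum_congr fun ω => ?_
  by_cases h : wordEquiv S.index n (a, ω) ∈ A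
  · rw [indicator_of_mem h, indicator_of_mem (by exact h), S.wordDeriv_succ hd n _ hx,
      wordInit_wordEquiv, wordLast_wordEquiv, ENNReal.mul_rpow_of_nonneg _ _ ht, mul_comm]
  · rw [indicator_of_notMem h, indicator_of_notMem (by exact h), mul_zero]

theorem wordSum_inter_admissible_succ (hd : 0 < d) {F : ℕ → Set ℕ} {n : ℕ}
    (A : Set (Word S.index 0 n)) {t : ℝ} (ht : 0 ≤ t) {x : E d} (hx : x ∈ S.V) :
    S.wordSum (S.admissible F (n + 1) ∩ {ω | wordInit ω ∈ A}) t x =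
      ∑' a : S.index (0 + n), {a : S.index (0 + n) | (a : ℕ) ∈ F n}.indicator (fun a =>
        S.letterDeriv (0 + n) a x ^ t *
          S.wordSum (S.admissible F n ∩ A) t (S.map (0 + n) a x)) a := by
  rw [S.wordSum_succ hd _ ht hx]
  refine tsum_congr fun a => ?_
  have hmem : ∀ ω, wordEquiv S.index n (a, ω) ∈
      S.admissible F (n + 1) ∩ {ω | wordInit ω ∈ A} ↔
      (ω ∈ S.admissible F n ∩ A ∧ (a : ℕ) ∈ F n) := by
    intro ω
    rw [mem_inter_iff, mem_admissible_succ, mem_ofPred_eq, wordInit_wordEquiv, wordLast_wordEquiv,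
      mem_inter_iff]
    tauto
  by_cases ha : (a : ℕ) ∈ F n
  · rw [indicator_of_mem (by exact ha)]
    congr 2
    ext ω
    rw [mem_ofPred_eq, hmem]
    exact and_iff_left ha
  · rw [indicator_of_notMem (by exact ha)]
    have : {ω | wordEquiv S.index n (a, ω) ∈
        S.admissible F (n + 1) ∩ {ω | wordInit ω ∈ A}} = ∅ := by
      ext ω
      rw [mem_ofPred_eq, hmem]
      simp [ha]
    rw [this]
    simp [wordSum]

theorem wordSum_admissible_succ (hd : 0 < d) {F : ℕ → Set ℕ} {n : ℕ} {t : ℝ} (ht : 0 ≤ t)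
    {x : E d} (hx : x ∈ S.V) : S.wordSum (S.admissible F (n + 1)) t x =
      ∑' a : S.index (0 + n), {a : S.index (0 + n) | (a : ℕ) ∈ F n}.indicator (fun a =>
        S.letterDeriv (0 + n) a x ^ t *
          S.wordSum (S.admissible F n) t (S.map (0 + n) a x)) a := by
  have h := S.wordSum_inter_admissible_succ hd (F := F) (n := n) univ ht hx
  simpa only [mem_univ, ofPred_true, inter_univ] using h

variable {S} in
theorem IsDistortion.wordSum_le {K : ℝ≥0} (hK : S.IsDistortion K) {n : ℕ}
    (A : Set (Word S.index 0 n)) {t : ℝ} (ht : 0 ≤ t) {x y : E d} (hx : x ∈ S.V) (hy : y ∈ S.V) :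
    S.wordSum A t x ≤ (K : ℝ≥0∞) ^ t * S.wordSum A t y := by
  simp only [wordSum]
  rw [← ENNReal.tsum_mul_left]
  refine ENNReal.tsum_le_tsum fun ω => indicator_apply_le' (fun hω => ?_) (fun _ => zero_le)
  rw [indicator_of_mem hω, ← ENNReal.mul_rpow_of_nonneg _ _ ht]
  exact ENNReal.rpow_le_rpow (hK.word n ω x hx y hy) ht

theorem wordSum_ne_top {n : ℕ} {A : Set (Word S.index 0 n)} (hA : A.Finite) {t : ℝ} (ht : 0 ≤ t)
    (x : E d) : S.wordSum A t x ≠ ⊤ := by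
  rw [wordSum, tsum_eq_sum (s := hA.toFinset)
    (fun ω hω => indicator_of_notMem (by simpa using hω) _)]
  refine ENNReal.sum_ne_top.2 fun ω hω => ?_
  rw [indicator_of_mem (by simpa using hω)]
  exact ENNReal.rpow_ne_top_of_nonneg ht (S.wordDeriv_ne_top n ω x)

/-- The words of length `n + 1` that reach size at most `r` with their last letter while their
parent meets the ball of radius `r` around `c`. -/
def newWords (c : E d) (r : ℝ) (n : ℕ) : Set (Word S.index 0 (n + 1)) :=
  {ω | ENNReal.ofReal r < S.wordNorm n (wordInit ω) ∧ S.wordNorm (n + 1) ω ≤ ENNReal.ofReal r ∧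
    (S.initialMap n (wordInit ω) '' X ∩ Metric.ball c r).Nonempty}

/-- The words with a prefix in `newWords`. -/
def smallWords (c : E d) (r : ℝ) : (n : ℕ) → Set (Word S.index 0 n)
  | 0 => ∅
  | n + 1 => {ω | wordInit ω ∈ smallWords c r n} ∪ S.newWords c r n

/-- The empty word has norm `1 > r`. All prefixes have larger images and so meet the ball too; if
the word is small, the first prefix of size at most `r` belongs to `newWords`. -/
theorem mem_smallWords_or (hd : 0 < d) (hne : X.Nonempty) {c : E d} {r : ℝ} (hr : r < 1) :
    ∀ (n : ℕ) (ω : Word S.index 0 n), (S.initialMap n ω '' X ∩ Metric.ball c r).Nonempty →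
      ω ∈ S.smallWords c r n ∨ ENNReal.ofReal r < S.wordNorm n ω
  | 0, ω, _ => by
    right
    rw [S.wordNorm_zero hd hne, ← ENNReal.ofReal_one]
    exact (ENNReal.ofReal_lt_ofReal_iff one_pos).2 hr
  | n + 1, ω, h => by
    have hsub : S.initialMap (n + 1) ω '' X ⊆ S.initialMap n (wordInit ω) '' X := by
      rw [initialMap_succ, image_comp]
      exact image_mono (S.mapsTo_X _ _).image_subset
    have h' := h.mono (inter_subset_inter_left _ hsub)
    rcases mem_smallWords_or hd hne hr n (wordInit ω) h' with h1 | h1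
    · exact Or.inl (Or.inl h1)
    · rcases le_or_gt (S.wordNorm (n + 1) ω) (ENNReal.ofReal r) with h2 | h2
      · exact Or.inl (Or.inr ⟨h1, h2, h'⟩)
      · exact Or.inr h2

/-- There are at most `N₀` possible parents, at most `#F n` letters to append, and each resulting
word has weight at most `r ^ t`. -/
theorem wordSum_newWords_le {N₀ : ℝ≥0∞} {c : E d} {r : ℝ}
    (F : ℕ → Finset ℕ) (n : ℕ) {t : ℝ} (ht : 0 ≤ t) {x : E d} (hx : x ∈ X)
    (hN₀ : ∀ T : Finset (Word S.index 0 n),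
      (∀ ω ∈ T, ENNReal.ofReal r < S.wordNorm n ω ∧
        (S.initialMap n ω '' X ∩ Metric.ball c r).Nonempty) → (T.card : ℝ≥0∞) ≤ N₀) :
    S.wordSum (S.admissible (fun n => F n) (n + 1) ∩ S.newWords c r n) t x ≤
      (F n).card * (N₀ * ENNReal.ofReal r ^ t) := by
  set G : Set (Word S.index 0 n) := {ω | ENNReal.ofReal r < S.wordNorm n ω ∧
    (S.initialMap n ω '' X ∩ Metric.ball c r).Nonempty} with hG
  rw [wordSum, tsum_word_succ]
  refine le_trans (ENNReal.tsum_le_tsum fun a => ?_)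
    (tsum_subtype_finset_le (I := S.index (0 + n)) (F n) (N₀ * ENNReal.ofReal r ^ t))
  by_cases ha : (a : ℕ) ∈ F n
  · rw [indicator_of_mem (by exact ha)]
    refine le_trans (ENNReal.tsum_le_tsum fun ω => ?_)
      (tsum_indicator_le_card (G := G) hN₀ (ENNReal.ofReal r ^ t))
    refine indicator_apply_le' (fun hω => ?_) (fun _ => zero_le)
    obtain ⟨-, h1, h2, h3⟩ := hω
    rw [wordInit_wordEquiv] at h1 h3
    rw [indicator_of_mem (show ω ∈ G from ⟨h1, h3⟩)]
    exact ENNReal.rpow_le_rpow ((S.wordDeriv_le_wordNorm _ _ hx).trans h2) ht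
  · rw [indicator_of_notMem (by exact ha)]
    refine le_of_eq (ENNReal.tsum_eq_zero.2 fun ω => indicator_of_notMem ?_ _)
    rintro ⟨h, -⟩
    rw [mem_admissible_succ, wordLast_wordEquiv] at h
    exact ha h.2

variable {S} in
-- A ball of radius `r` captures only a multiple of `r ^ t` of the total weight. The proportion
-- captured earlier is kept under extension, since numerator and denominator evolve under the same
-- positive operator and the bound holds at every point of `X`. The new words add the term `k = n`;
-- only there does distortion enter, to compare `x` with `x₀`.
theorem IsDistortion.wordSum_smallWords_le {K : ℝ≥0} (hK : S.IsDistortion K) (hd : 0 < d)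
    {N₀ : ℝ≥0∞} {c : E d} {r : ℝ}
    (hN₀ : ∀ (n : ℕ) (T : Finset (Word S.index 0 n)),
      (∀ ω ∈ T, ENNReal.ofReal r < S.wordNorm n ω ∧
        (S.initialMap n ω '' X ∩ Metric.ball c r).Nonempty) → (T.card : ℝ≥0∞) ≤ N₀)
    {F : ℕ → Finset ℕ} {t : ℝ} (ht : 0 ≤ t) {x₀ : E d} (hx₀ : x₀ ∈ X)
    (hpos : ∀ n, S.wordSum (S.admissible (fun n => F n) n) t x₀ ≠ 0) :
    ∀ n, ∀ x ∈ X, S.wordSum (S.admissible (fun n => F n) n ∩ S.smallWords c r n) t x ≤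
      ((N₀ * (K : ℝ≥0∞) ^ t * ∑ k ∈ Finset.range n,
        (F k).card / S.wordSum (S.admissible (fun n => F n) (k + 1)) t x₀) *
          ENNReal.ofReal r ^ t) * S.wordSum (S.admissible (fun n => F n) n) t x := by
  intro n
  induction n with
  | zero => intro x hx; simp [smallWords, wordSum]
  | succ n ih =>
    intro x hx
    have hxV := S.subset_V hx
    set Q := ∑ k ∈ Finset.range n,
        ((F k).card : ℝ≥0∞) / S.wordSum (S.admissible (fun n => F n) (k + 1)) t x₀ with hQ
    set f₀ := S.wordSum (S.admissible (fun n => F n) (n + 1)) t x₀ with hf₀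
    set f := S.wordSum (S.admissible (fun n => F n) (n + 1)) t x with hf
    have hf₀t : f₀ ≠ ⊤ := S.wordSum_ne_top (S.finite_admissible F _) ht x₀
    rw [smallWords, inter_union_distrib_left, Finset.sum_range_succ]
    refine (S.wordSum_union_le _ _ t x).trans ?_
    have h1 : S.wordSum (S.admissible (fun n => F n) (n + 1) ∩
        {ω | wordInit ω ∈ S.smallWords c r n}) t x ≤
        (N₀ * (K : ℝ≥0∞) ^ t * Q * ENNReal.ofReal r ^ t) * f := by
      rw [S.wordSum_inter_admissible_succ hd _ ht hxV, hf,
        S.wordSum_admissible_succ hd ht hxV, ← ENNReal.tsum_mul_left]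
      refine ENNReal.tsum_le_tsum fun a => indicator_apply_le' (fun ha => ?_) (fun _ => zero_le)
      rw [indicator_of_mem ha, mul_left_comm]
      gcongr
      exact ih _ (S.mapsTo_X _ _ hx)
    have h2 : S.wordSum (S.admissible (fun n => F n) (n + 1) ∩ S.newWords c r n) t x ≤
        (N₀ * (K : ℝ≥0∞) ^ t * ((F n).card / f₀) * ENNReal.ofReal r ^ t) * f := by
      refine (S.wordSum_newWords_le F n ht hx (hN₀ n)).trans ?_
      have h3 : f₀ ≤ (K : ℝ≥0∞) ^ t * f := hK.wordSum_le _ ht (S.subset_V hx₀) hxV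
      calc ((F n).card : ℝ≥0∞) * (N₀ * ENNReal.ofReal r ^ t)
          = ((F n).card : ℝ≥0∞) * (N₀ * ENNReal.ofReal r ^ t) * (f₀ / f₀) := by
            rw [ENNReal.div_self (hpos _) hf₀t, mul_one]
        _ ≤ ((F n).card : ℝ≥0∞) * (N₀ * ENNReal.ofReal r ^ t) * ((K : ℝ≥0∞) ^ t * f / f₀) := by
            gcongr
        _ = _ := by simp only [div_eq_mul_inv]; ring
    refine (add_le_add h1 h2).trans (le_of_eq ?_)
    ring

/-- Finite stages of the limit set of a subsystem. -/
def stage (F : ℕ → Set ℕ) (n : ℕ) : Set (E d) :=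
  ⋃ ω ∈ S.admissible F n, S.initialMap n ω '' X

theorem stage_antitone (F : ℕ → Set ℕ) : Antitone (S.stage F) := by
  refine antitone_nat_of_succ_le fun n => ?_
  refine iUnion₂_subset fun ω hω => ?_
  rw [mem_admissible_succ] at hω
  rw [initialMap_succ, image_comp]
  exact (image_mono (S.mapsTo_X _ _).image_subset).trans
    (subset_biUnion_of_mem (u := fun ω => S.initialMap n ω '' X) hω.1)

theorem isCompact_stage (hc : IsCompact X) (F : ℕ → Finset ℕ) (n : ℕ) :
    IsCompact (S.stage (fun n => F n) n) :=
  (S.finite_admissible F n).isCompact_biUnion fun ω _ =>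
    hc.image_of_continuousOn ((S.initialMap_continuousOn n ω).mono S.subset_V)

theorem iInter_stage_subset (F : ℕ → Set ℕ) : ⋂ n, S.stage F n ⊆ S.limitSet := by
  intro x hx
  refine mem_iInter.2 fun n => ?_
  obtain ⟨ω, -, h⟩ := mem_iUnion₂.1 (mem_iInter.1 hx (n + 1))
  exact mem_iUnion.2 ⟨ω, h⟩

/-- A mass distribution principle without a limit measure: if the dimension were below `t`, a cover
with tiny `∑ r_i^t` would, by compactness of the finite stages, account for all words of some level,
although it captures less than their total weight. -/
theorem le_dimH_limitSet_of_tsum_ne_top (hd : 0 < d) (hX : IsPhaseSpace X) {F : ℕ → Finset ℕ}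
    {t : ℝ≥0} {x₀ : E d} (hx₀ : x₀ ∈ X)
    (hpos : ∀ n, S.wordSum (S.admissible (fun n => F n) n) t x₀ ≠ 0)
    (hsum : ∑' n, ((F n).card : ℝ≥0∞) /
      S.wordSum (S.admissible (fun n => F n) (n + 1)) t x₀ ≠ ⊤) :
    (t : ℝ≥0∞) ≤ dimH S.limitSet := by
  by_contra! hlt
  have ht : 0 < (t : ℝ) := by
    have := (zero_le (a := dimH S.limitSet)).trans_lt hlt
    exact_mod_cast this
  obtain ⟨K, hK⟩ := S.exists_isDistortion
  obtain ⟨N₀, hN₀⟩ := S.exists_card_le hd hX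
  obtain ⟨η, h0, h1, N, hη⟩ := S.exists_wordNorm_le
  set C : ℝ≥0∞ := N₀ * (K : ℝ≥0∞) ^ (t : ℝ) * ∑' n, ((F n).card : ℝ≥0∞) /
    S.wordSum (S.admissible (fun n => F n) (n + 1)) t x₀ with hC
  have hCt : C ≠ ⊤ := ENNReal.mul_ne_top (ENNReal.mul_ne_top ENNReal.coe_ne_top
    (ENNReal.rpow_ne_top_of_nonneg ht.le ENNReal.coe_ne_top)) hsum
  have hC1 : C + 1 ≠ ⊤ := ENNReal.add_ne_top.2 ⟨hCt, ENNReal.one_ne_top⟩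
  -- With total size at most `1 / (C + 1)`, the captured proportion is at most `C / (C + 1) < 1`.
  obtain ⟨c, r, hr, hcov, hsmall⟩ := exists_ball_cover ht (hausdorffMeasure_of_dimH_lt hlt)
    (ε := (C + 1)⁻¹) (ENNReal.inv_ne_zero.2 hC1)
  have hsub : ⋂ n, S.stage (fun n => F n) n ⊆ ⋃ i, Metric.ball (c i) (r i) :=
    (S.iInter_stage_subset _).trans hcov
  have hopen : IsOpen (⋃ i, Metric.ball (c i) (r i)) := isOpen_iUnion fun _ => Metric.isOpen_ball
  obtain ⟨n₀, hn₀⟩ := exists_subset_nhds_of_isCompact (S.stage_antitone (fun n => F n)).directed_ge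
    (S.isCompact_stage hX.isCompact F) (fun x hx => hopen.mem_nhds (hsub hx))
  obtain ⟨s, hs⟩ := (S.isCompact_stage hX.isCompact F n₀).elim_finite_subcover _
    (fun _ => Metric.isOpen_ball) hn₀
  -- Only finitely many balls remain, so at a deep enough level every word is smaller than all of
  -- them, and a word meeting a ball must be one of its `smallWords`.
  have hev : ∀ᶠ n : ℕ in atTop, ∀ i ∈ s, η ^ n < r i := by
    rw [Filter.eventually_all_finset]
    exact fun i _ => (tendsto_pow_atTop_nhds_zero_of_lt_one h0.le h1).eventually_lt_const (hr i).1
  obtain ⟨n, hn1, hn2, hn3⟩ := (hev.and ((eventually_ge_atTop N).and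
    (eventually_ge_atTop n₀))).exists
  set f := S.wordSum (S.admissible (fun n => F n) (n + 1)) t x₀ with hf
  have hft : f ≠ ⊤ := S.wordSum_ne_top (S.finite_admissible F _) ht.le x₀
  have hf0 : f ≠ 0 := hpos _
  have hcover : S.admissible (fun n => F n) (n + 1) ⊆
      ⋃ i ∈ s, (S.admissible (fun n => F n) (n + 1) ∩ S.smallWords (c i) (r i) (n + 1)) := by
    intro ω hω
    have hz : S.initialMap (n + 1) ω x₀ ∈ S.stage (fun n => F n) n₀ :=
      S.stage_antitone _ (hn3.trans (Nat.le_succ n))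
        (mem_iUnion₂.2 ⟨ω, hω, x₀, hx₀, rfl⟩)
    obtain ⟨i, hi, hzi⟩ := mem_iUnion₂.1 (hs hz)
    refine mem_iUnion₂.2 ⟨i, hi, hω, ?_⟩
    refine (S.mem_smallWords_or hd hX.nonempty (hr i).2 (n + 1) ω
      ⟨_, ⟨x₀, hx₀, rfl⟩, hzi⟩).resolve_right (not_lt.2 ?_)
    exact (hη n hn2 ω).trans (ENNReal.ofReal_le_ofReal (hn1 i hi).le)
  have hbound : f ≤ C * (∑ i ∈ s, ENNReal.ofReal (r i) ^ (t : ℝ)) * f := by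
    calc f ≤ ∑ i ∈ s, S.wordSum (S.admissible (fun n => F n) (n + 1) ∩
          S.smallWords (c i) (r i) (n + 1)) t x₀ :=
          (S.wordSum_mono hcover _ _).trans (S.wordSum_biUnion_le _ _ _ _)
      _ ≤ ∑ i ∈ s, C * ENNReal.ofReal (r i) ^ (t : ℝ) * f := by
          refine Finset.sum_le_sum fun i _ => ?_
          refine (hK.wordSum_smallWords_le hd (fun n T => hN₀ n (r i) (c i) T (hr i).1) ht.le hx₀
            hpos (n + 1) x₀ hx₀).trans ?_
          gcongr
          rw [hC]
          gcongr
          exact ENNReal.sum_le_tsum _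
      _ = _ := by rw [← Finset.sum_mul, ← Finset.mul_sum]
  have hlt1 : C * (∑ i ∈ s, ENNReal.ofReal (r i) ^ (t : ℝ)) < 1 := by
    calc _ ≤ C * (C + 1)⁻¹ := by
          gcongr
          exact (ENNReal.sum_le_tsum _).trans hsmall
      _ < (C + 1) * (C + 1)⁻¹ := by
          refine ENNReal.mul_lt_mul_left (ENNReal.inv_ne_zero.2 hC1)
            (ENNReal.inv_ne_top.2 (by simp)) (ENNReal.lt_add_right hCt one_ne_zero)
      _ = 1 := ENNReal.mul_inv_cancel (by simp) hC1
  have hcontra := ENNReal.mul_lt_mul_left hf0 hft hlt1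
  rw [one_mul] at hcontra
  exact absurd hbound (not_le.2 hcontra)

end NCIFS

/-! ### Truncating the alphabets. -/

theorem tsum_ne_top_of_eventually_le {g h : ℕ → ℝ≥0∞} (hg : ∀ n, g n ≠ ⊤)
    (hgh : ∀ᶠ n in atTop, g n ≤ h n) (hh : ∑' n, h n ≠ ⊤) : ∑' n, g n ≠ ⊤ := by
  obtain ⟨N, hN⟩ := eventually_atTop.1 hgh
  have hle : ∀ n, g n ≤ (Finset.range N : Set ℕ).indicator g n + h n := by
    intro n
    by_cases hn : n < N
    · rw [indicator_of_mem (by simpa using hn)]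
      exact le_self_add
    · exact (hN n (not_lt.1 hn)).trans le_add_self
  refine ne_top_of_le_ne_top ?_ ((ENNReal.tsum_le_tsum hle).trans_eq ENNReal.tsum_add)
  refine ENNReal.add_ne_top.2 ⟨?_, hh⟩
  rw [tsum_eq_sum (s := Finset.range N) (fun n hn => indicator_of_notMem (by simpa using hn) _)]
  refine ENNReal.sum_ne_top.2 fun n hn => ?_
  rw [indicator_of_mem (Finset.mem_coe.2 hn)]
  exact hg n

theorem ofReal_one_sub_mul_le {T u : ℝ≥0∞} {δ : ℝ} (hδ : 0 ≤ δ) (hT : T ≠ ⊤)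
    (h : T ≤ u + ENNReal.ofReal δ * T) : ENNReal.ofReal (1 - δ) * T ≤ u := by
  rcases le_total δ 1 with h1 | h1
  · have hfin : ENNReal.ofReal δ * T ≠ ⊤ := ENNReal.mul_ne_top ENNReal.ofReal_ne_top hT
    rw [← ENNReal.add_le_add_iff_right hfin, ← add_mul, ← ENNReal.ofReal_add (by linarith) hδ]
    simpa using h
  · rw [ENNReal.ofReal_of_nonpos (by linarith), zero_mul]
    exact zero_le

namespace NCIFS

variable {d : ℕ} {X : Set (E d)} (S : NCIFS X)

/-- The part of the level sum coming from the letters in `F`. -/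
noncomputable def restrictedSum (n : ℕ) (F : Set ℕ) (t : ℝ) : ℝ≥0∞ :=
  ∑' a : S.index n, {a : S.index n | (a : ℕ) ∈ F}.indicator (fun a => S.letterNorm n a ^ t) a

theorem levelSumUpTo_eq (n : ℕ) (R t : ℝ) :
    S.levelSumUpTo n R t = S.restrictedSum n {k | (k : ℝ) + 1 ≤ R} t :=
  tsum_subtype {k : S.index n | ((k : ℕ) : ℝ) + 1 ≤ R} (fun k => S.letterNorm n k ^ t)

theorem restrictedSum_mono (n : ℕ) {F G : Set ℕ} (h : F ⊆ G) (t : ℝ) :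
    S.restrictedSum n F t ≤ S.restrictedSum n G t :=
  ENNReal.tsum_le_tsum fun a => indicator_le_indicator_of_subset
    (s := {a : S.index n | (a : ℕ) ∈ F}) (t := {a : S.index n | (a : ℕ) ∈ G})
    (fun _ ha => h ha) (fun _ => zero_le) a

theorem levelSum_eq_add (n : ℕ) (F : Set ℕ) (t : ℝ) :
    S.levelSum n t = S.restrictedSum n F t + S.restrictedSum n Fᶜ t := by
  rw [restrictedSum, restrictedSum, ← ENNReal.tsum_add]
  refine tsum_congr fun a => ?_
  have h := congrFun (indicator_self_add_compl {a : S.index n | (a : ℕ) ∈ F}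
    (fun a => S.letterNorm n a ^ t)) a
  exact h.symm

theorem restrictedSum_le_levelSum (n : ℕ) (F : Set ℕ) (t : ℝ) :
    S.restrictedSum n F t ≤ S.levelSum n t := by
  rw [S.levelSum_eq_add n F t]
  exact le_self_add

theorem setOf_add_one_le_eq {R : ℝ} (hR : 0 ≤ R) :
    {k : ℕ | (k : ℝ) + 1 ≤ R} = (Finset.range ⌊R⌋₊ : Set ℕ) := by
  ext k
  rw [mem_ofPred_eq, Finset.mem_coe, Finset.mem_range, ← Nat.succ_le_iff, Nat.le_floor_iff hR]
  push_cast
  rfl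

theorem exists_finset_le_restrictedSum (n : ℕ) (t : ℝ) {c : ℝ≥0∞} (hc : c < S.levelSum n t) :
    ∃ G : Finset ℕ, c ≤ S.restrictedSum n G t := by
  rw [levelSum, ENNReal.tsum_eq_iSup_sum, lt_iSup_iff] at hc
  obtain ⟨s, hs⟩ := hc
  refine ⟨s.map (Function.Embedding.subtype _), hs.le.trans ?_⟩
  refine le_trans (le_of_eq (Finset.sum_congr rfl fun a ha => ?_)) (ENNReal.sum_le_tsum s)
  rw [indicator_of_mem]
  · rfl
  · simpa using ha

variable {S} in
theorem IsDistortion.wordSum_admissible_le {K : ℝ≥0} (hK : S.IsDistortion K)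
    (F : ℕ → Set ℕ) (n : ℕ) {t : ℝ} (ht : 0 ≤ t) {x y : E d} (hx : x ∈ X) (hy : y ∈ X) :
    S.wordSum (S.admissible F n) t x ≤ (K : ℝ≥0∞) ^ t * S.wordSum (S.admissible F n) t y :=
  hK.wordSum_le _ ht (S.subset_V hx) (S.subset_V hy)

/-- One application of the transfer operator is bounded above by the level sum. -/
theorem tsum_letter_le {K : ℝ≥0} {g : E d → ℝ≥0∞} {t : ℝ} (ht : 0 ≤ t)
    (hg : ∀ x ∈ X, ∀ y ∈ X, g x ≤ (K : ℝ≥0∞) ^ t * g y) (n : ℕ) (F : Set ℕ) {x : E d}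
    (hx : x ∈ X) :
    ∑' a : S.index n, {a : S.index n | (a : ℕ) ∈ F}.indicator (fun a =>
      S.letterDeriv n a x ^ t * g (S.map n a x)) a ≤
      S.restrictedSum n F t * ((K : ℝ≥0∞) ^ t * g x) := by
  rw [restrictedSum, ← ENNReal.tsum_mul_right]
  refine ENNReal.tsum_le_tsum fun a => indicator_apply_le' (fun ha => ?_) (fun _ => zero_le)
  rw [indicator_of_mem ha]
  gcongr
  · exact S.letterDeriv_le_letterNorm n a hx
  · exact hg _ (S.mapsTo_X _ _ hx) x hx

/-- One application of the transfer operator is bounded below by the level sum. -/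
theorem restrictedSum_mul_le {K : ℝ≥0} (hK : S.IsDistortion K) {g : E d → ℝ≥0∞} {t : ℝ}
    (ht : 0 ≤ t) (hg : ∀ x ∈ X, ∀ y ∈ X, g x ≤ (K : ℝ≥0∞) ^ t * g y) (n : ℕ) (F : Set ℕ)
    {x : E d} (hx : x ∈ X) : S.restrictedSum n F t * g x ≤
      (K : ℝ≥0∞) ^ t * (K : ℝ≥0∞) ^ t *
        ∑' a : S.index n, {a : S.index n | (a : ℕ) ∈ F}.indicator (fun a =>
          S.letterDeriv n a x ^ t * g (S.map n a x)) a := by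
  rw [restrictedSum, ← ENNReal.tsum_mul_right, ← ENNReal.tsum_mul_left]
  refine ENNReal.tsum_le_tsum fun a => ?_
  by_cases ha : a ∈ {a : S.index n | (a : ℕ) ∈ F}
  · rw [indicator_of_mem ha, indicator_of_mem ha]
    have h1 : S.letterNorm n a ^ t ≤ (K : ℝ≥0∞) ^ t * S.letterDeriv n a x ^ t := by
      rw [← ENNReal.mul_rpow_of_nonneg _ _ ht]
      exact ENNReal.rpow_le_rpow (hK.letterNorm_le n a (S.subset_V hx)) ht
    calc _ ≤ ((K : ℝ≥0∞) ^ t * S.letterDeriv n a x ^ t) *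
          ((K : ℝ≥0∞) ^ t * g (S.map n a x)) := by
            gcongr
            exact hg x hx _ (S.mapsTo_X _ _ hx)
      _ = _ := by ring
  · rw [indicator_of_notMem ha, zero_mul]
    exact zero_le

theorem wordSum_univ_ne_top {K : ℝ≥0} (hK : S.IsDistortion K) (hd : 0 < d) {t : ℝ} (ht : 0 ≤ t)
    (hfin : ∀ n, S.levelSum n t < ⊤) : ∀ n, ∀ x ∈ X,
      S.wordSum (S.admissible (fun _ => univ) n) t x ≠ ⊤ := by
  intro n
  induction n with
  | zero =>
    intro x _
    rw [S.wordSum_zero hd (S.admissible_univ 0)]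
    exact ENNReal.one_ne_top
  | succ n ih =>
    intro x hx
    rw [S.wordSum_admissible_succ hd ht (S.subset_V hx)]
    refine ne_top_of_le_ne_top ?_ (S.tsum_letter_le ht
      (fun x hx y hy => hK.wordSum_admissible_le _ n ht hx hy) (0 + n) _ hx)
    refine ENNReal.mul_ne_top ?_ (ENNReal.mul_ne_top
      (ENNReal.rpow_ne_top_of_nonneg ht ENNReal.coe_ne_top) (ih x hx))
    exact ne_top_of_le_ne_top (hfin _).ne (S.restrictedSum_le_levelSum _ _ _)

/-- Truncating the alphabets costs at most a factor per level if the truncated level sums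
are relatively close to the full ones. -/
theorem pow_mul_wordSum_le {K : ℝ≥0} (hK : S.IsDistortion K) (hd : 0 < d) {t : ℝ} (ht : 0 ≤ t)
    (hfin : ∀ n, S.levelSum n t < ⊤) {F : ℕ → Set ℕ} {δ δ' : ℝ} (hδ : 0 ≤ δ) (hδ1 : δ ≤ 1)
    (hδ' : δ' = δ * ((K : ℝ) ^ t * (K : ℝ) ^ t * (K : ℝ) ^ t))
    (hF : ∀ n, ENNReal.ofReal (1 - δ) * S.levelSum n t ≤ S.restrictedSum n (F n) t) :
    ∀ n, ∀ x ∈ X, ENNReal.ofReal (1 - δ') ^ n * S.wordSum (S.admissible (fun _ => univ) n) t x ≤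
      S.wordSum (S.admissible F n) t x := by
  intro n
  induction n with
  | zero =>
    intro x _
    rw [S.wordSum_zero hd (S.admissible_univ 0),
      S.wordSum_zero hd (S.admissible_zero F)]
    simp
  | succ n ih =>
    intro x hx
    have hδ'0 : 0 ≤ δ' := by rw [hδ']; positivity
    set g : E d → ℝ≥0∞ := S.wordSum (S.admissible (fun _ => univ) n) t with hg
    have hgo : ∀ x ∈ X, ∀ y ∈ X, g x ≤ (K : ℝ≥0∞) ^ t * g y :=
      fun x hx y hy => hK.wordSum_admissible_le _ n ht hx hy
    set T := S.levelSum (0 + n) t with hT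
    have hTt : T ≠ ⊤ := (hfin _).ne
    set f := S.wordSum (S.admissible (fun _ => univ) (n + 1)) t x with hf
    have hft : f ≠ ⊤ := S.wordSum_univ_ne_top hK hd ht hfin (n + 1) x hx
    set opSum : Set ℕ → ℝ≥0∞ := fun G => ∑' a : S.index (0 + n),
      {a : S.index (0 + n) | (a : ℕ) ∈ G}.indicator (fun a =>
        S.letterDeriv (0 + n) a x ^ t * g (S.map (0 + n) a x)) a with hop
    have hfop : f = opSum univ := S.wordSum_admissible_succ hd ht (S.subset_V hx)
    have hsplit : opSum univ = opSum (F n) + opSum (F n)ᶜ := by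
      simp only [hop]
      rw [← ENNReal.tsum_add]
      refine tsum_congr fun a => ?_
      have h := congrFun (indicator_self_add_compl {a : S.index (0 + n) | (a : ℕ) ∈ F n}
        (fun a => S.letterDeriv (0 + n) a x ^ t * g (S.map (0 + n) a x))) a
      rw [indicator_of_mem (s := {a : S.index (0 + n) | (a : ℕ) ∈ (univ : Set ℕ)}) (mem_univ _)]
      exact h.symm
    have hFn : ENNReal.ofReal (1 - δ) * T ≤ S.restrictedSum (0 + n) (F n) t := by
      have := hF n
      rwa [hT, Nat.zero_add]
    have htail : S.restrictedSum (0 + n) (F n)ᶜ t ≤ ENNReal.ofReal δ * T := by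
      have hcan : ENNReal.ofReal (1 - δ) * T ≠ ⊤ := ENNReal.mul_ne_top ENNReal.ofReal_ne_top hTt
      rw [← ENNReal.add_le_add_iff_left hcan, ← add_mul,
        ← ENNReal.ofReal_add (by linarith) hδ, sub_add_cancel, ENNReal.ofReal_one, one_mul, hT,
        S.levelSum_eq_add (0 + n) (F n) t]
      rw [hT, S.levelSum_eq_add (0 + n) (F n) t] at hFn
      gcongr
    have hTg : T * g x ≤ (K : ℝ≥0∞) ^ t * (K : ℝ≥0∞) ^ t * f := by
      have h := S.restrictedSum_mul_le hK ht hgo (0 + n) univ hx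
      have h2 : S.restrictedSum (0 + n) univ t = T :=
        tsum_congr fun a => indicator_of_mem (mem_univ _) _
      rw [h2] at h
      rw [hfop]
      exact h
    -- One factor `K ^ t` comes from replacing `g (φ_a x)` by `g x`, two from bounding `T * g x` by
    -- `f`; together they give the ratio `δ' / δ`.
    have hcomp : opSum (F n)ᶜ ≤ ENNReal.ofReal δ' * f := by
      calc opSum (F n)ᶜ ≤ S.restrictedSum (0 + n) (F n)ᶜ t * ((K : ℝ≥0∞) ^ t * g x) :=
            S.tsum_letter_le ht hgo (0 + n) _ hx
        _ ≤ ENNReal.ofReal δ * T * ((K : ℝ≥0∞) ^ t * g x) := by gcongr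
        _ = ENNReal.ofReal δ * (K : ℝ≥0∞) ^ t * (T * g x) := by ring
        _ ≤ ENNReal.ofReal δ * (K : ℝ≥0∞) ^ t *
            ((K : ℝ≥0∞) ^ t * (K : ℝ≥0∞) ^ t * f) := by gcongr
        _ = ENNReal.ofReal δ' * f := by
            rw [hδ', ENNReal.ofReal_mul hδ, ENNReal.ofReal_mul (by positivity),
              ENNReal.ofReal_mul (by positivity), ← ENNReal.ofReal_rpow_of_nonneg K.coe_nonneg ht,
              ENNReal.ofReal_coe_nnreal]
            ring
    have hmain : ENNReal.ofReal (1 - δ') * f ≤ opSum (F n) := by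
      refine ofReal_one_sub_mul_le hδ'0 hft ?_
      calc f = opSum (F n) + opSum (F n)ᶜ := by rw [hfop, hsplit]
        _ ≤ _ := by gcongr
    -- The induction hypothesis is applied at the points `φ_a x` inside the operator, so the losses
    -- multiply as `(1 - δ') ^ n` and distortion constants do not accumulate.
    calc ENNReal.ofReal (1 - δ') ^ (n + 1) * f
        = ENNReal.ofReal (1 - δ') ^ n * (ENNReal.ofReal (1 - δ') * f) := by ring
      _ ≤ ENNReal.ofReal (1 - δ') ^ n * opSum (F n) := by gcongr
      _ ≤ S.wordSum (S.admissible F (n + 1)) t x := by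
          rw [S.wordSum_admissible_succ hd ht (S.subset_V hx), ← ENNReal.tsum_mul_left]
          refine ENNReal.tsum_le_tsum fun a => ?_
          by_cases ha : a ∈ {a : S.index (0 + n) | (a : ℕ) ∈ F n}
          · rw [indicator_of_mem ha, indicator_of_mem ha, mul_left_comm]
            gcongr
            exact ih _ (S.mapsTo_X _ _ hx)
          · rw [indicator_of_notMem ha, mul_zero]
            exact zero_le

/-- When the level sums are infinite, truncated sums can be made large enough to absorb the
distortion loss `K ^ t * K ^ t` at every level, so crude bounds suffice. -/
theorem pow_le_wordSum {K : ℝ≥0} (hK : S.IsDistortion K) (hd : 0 < d) {t : ℝ} (ht : 0 ≤ t)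
    {F : ℕ → Set ℕ} {D : ℝ≥0∞}
    (hF : ∀ n, (K : ℝ≥0∞) ^ t * (K : ℝ≥0∞) ^ t * D ≤ S.restrictedSum n (F n) t) :
    ∀ n, ∀ x ∈ X, D ^ n ≤ S.wordSum (S.admissible F n) t x := by
  intro n
  induction n with
  | zero =>
    intro x _
    rw [S.wordSum_zero hd (S.admissible_zero F), pow_zero]
  | succ n ih =>
    intro x hx
    have hKt : (K : ℝ≥0∞) ^ t ≠ ⊤ := ENNReal.rpow_ne_top_of_nonneg ht ENNReal.coe_ne_top
    have hK0 : (K : ℝ≥0∞) ^ t ≠ 0 := by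
      have : 0 < K := one_pos.trans_le hK.one_le
      exact (ENNReal.rpow_pos (by exact_mod_cast this) ENNReal.coe_ne_top).ne'
    have h := S.restrictedSum_mul_le hK ht
      (fun x hx y hy => hK.wordSum_admissible_le F n ht hx hy) (0 + n) (F n) hx
    rw [← S.wordSum_admissible_succ hd ht (S.subset_V hx)] at h
    have hFn : (K : ℝ≥0∞) ^ t * (K : ℝ≥0∞) ^ t * D ≤ S.restrictedSum (0 + n) (F n) t := by
      have := hF n
      rwa [Nat.zero_add]
    have h2 : (K : ℝ≥0∞) ^ t * (K : ℝ≥0∞) ^ t * D ^ (n + 1) ≤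
        (K : ℝ≥0∞) ^ t * (K : ℝ≥0∞) ^ t * S.wordSum (S.admissible F (n + 1)) t x := by
      refine le_trans ?_ h
      calc _ = (K : ℝ≥0∞) ^ t * (K : ℝ≥0∞) ^ t * D * D ^ n := by ring
        _ ≤ _ := by
          gcongr
          exact ih x hx
    exact (ENNReal.mul_le_mul_iff_right (mul_ne_zero hK0 hK0) (ENNReal.mul_ne_top hKt hKt)).1 h2

theorem le_dimH_of_exponential_growth (hd : 0 < d) (hX : IsPhaseSpace X) {F : ℕ → Finset ℕ}
    {t : ℝ≥0} {x₀ : E d} (hx₀ : x₀ ∈ X) {a ε C : ℝ} {B : ℝ≥0∞} (hB : B ≠ ⊤) (hε : ε < a)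
    (hC : 0 ≤ C) (hcard : ∀ n, ((F n).card : ℝ) ≤ C * Real.exp (ε * n))
    (hgrow : ∀ᶠ n : ℕ in atTop, ENNReal.ofReal (Real.exp (a * n)) ≤
      B * S.wordSum (S.admissible (fun n => F n) n) t x₀) :
    (t : ℝ≥0∞) ≤ dimH S.limitSet := by
  obtain ⟨K, hK⟩ := S.exists_isDistortion
  set f : ℕ → ℝ≥0∞ := fun n => S.wordSum (S.admissible (fun n => F n) n) t x₀ with hf
  -- Vanishing weights would persist and contradict the growth, so all the denominators below are
  -- nonzero.
  have hstep : ∀ n, f n = 0 → f (n + 1) = 0 := by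
    intro n hn
    have h := S.tsum_letter_le t.coe_nonneg
      (fun x hx y hy => hK.wordSum_admissible_le (fun n => F n) n t.coe_nonneg hx hy)
      (0 + n) (F n) hx₀
    rw [← S.wordSum_admissible_succ (F := fun n => F n) hd t.coe_nonneg (S.subset_V hx₀)] at h
    change f (n + 1) ≤ _ * (_ * f n) at h
    rw [hn, mul_zero, mul_zero] at h
    exact nonpos_iff_eq_zero.1 h
  have hpos : ∀ n, f n ≠ 0 := by
    intro n hn
    have hall : ∀ m, n ≤ m → f m = 0 := fun m hm => by
      induction m, hm using Nat.le_induction with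
      | base => exact hn
      | succ m _ ih => exact hstep m ih
    obtain ⟨m, hm, hm2⟩ := (hgrow.and (eventually_ge_atTop n)).exists
    change _ ≤ B * f m at hm
    rw [hall m hm2, mul_zero, nonpos_iff_eq_zero, ENNReal.ofReal_eq_zero] at hm
    exact absurd (Real.exp_pos (a * m)) (not_lt.2 hm)
  refine S.le_dimH_limitSet_of_tsum_ne_top hd hX hx₀ hpos ?_
  -- The bound `f (n + 1) ≥ exp (a (n + 1)) / B` against `#F n ≤ C exp (ε n)` gives a geometric
  -- majorant of ratio `exp (ε - a) < 1`.
  refine tsum_ne_top_of_eventually_le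
    (h := fun n => ENNReal.ofReal (C * Real.exp (-a)) * B * ENNReal.ofReal (Real.exp (ε - a)) ^ n)
    (fun n => ENNReal.div_ne_top (ENNReal.natCast_ne_top _) (hpos _)) ?_ ?_
  · filter_upwards [(tendsto_add_atTop_nat 1).eventually hgrow] with n hn
    refine ENNReal.div_le_of_le_mul ?_
    change _ ≤ B * f (n + 1) at hn
    calc ((F n).card : ℝ≥0∞) = ENNReal.ofReal ((F n).card : ℝ) := by
          rw [ENNReal.ofReal_natCast]
      _ ≤ ENNReal.ofReal (C * Real.exp (ε * n)) := ENNReal.ofReal_le_ofReal (hcard n)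
      _ = ENNReal.ofReal (C * Real.exp (-a)) * ENNReal.ofReal (Real.exp (ε - a)) ^ n *
            ENNReal.ofReal (Real.exp (a * (n + 1 : ℕ))) := by
          rw [← ENNReal.ofReal_pow (Real.exp_pos _).le, ← ENNReal.ofReal_mul (by positivity),
            ← ENNReal.ofReal_mul (by positivity), ← Real.exp_nat_mul, mul_assoc, mul_assoc,
            ← Real.exp_add, ← Real.exp_add]
          congr 3
          push_cast
          ring
      _ ≤ ENNReal.ofReal (C * Real.exp (-a)) * ENNReal.ofReal (Real.exp (ε - a)) ^ n *
            (B * f (n + 1)) := by gcongr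
      _ = _ := by ring
  · rw [ENNReal.tsum_mul_left]
    refine ENNReal.mul_ne_top (ENNReal.mul_ne_top ENNReal.ofReal_ne_top hB) ?_
    rw [ENNReal.tsum_geometric, ENNReal.inv_ne_top, Ne, tsub_eq_zero_iff_le, not_le,
      ← ENNReal.ofReal_one]
    exact (ENNReal.ofReal_lt_ofReal_iff one_pos).2 (by
      rw [Real.exp_lt_one_iff]; linarith)

/-- Bowen's formula holds if the alphabets can be truncated to finite sets of small exponential
growth without much loss. -/
theorem bowenFormula_of_truncation (hd : 0 < d) (hX : IsPhaseSpace X)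
    (H : ∀ t : ℝ, 0 < t → t < d → ∀ ε : ℝ, 0 < ε →
      ((∀ n, S.levelSum n t < ⊤) ∧ ∀ δ : ℝ, 0 < δ → ∃ (F : ℕ → Finset ℕ) (C : ℝ), 0 ≤ C ∧
        (∀ n, ((F n).card : ℝ) ≤ C * Real.exp (ε * n)) ∧
        ∀ n, ENNReal.ofReal (1 - δ) * S.levelSum n t ≤ S.restrictedSum n (F n) t) ∨
      (∀ D : ℝ≥0, ∃ (F : ℕ → Finset ℕ) (C : ℝ), 0 ≤ C ∧
        (∀ n, ((F n).card : ℝ) ≤ C * Real.exp (ε * n)) ∧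
        ∀ n, (D : ℝ≥0∞) ≤ S.restrictedSum n (F n) t)) :
    S.BowenFormula := by
  refine le_antisymm (S.dimH_limitSet_le hX) (iSup₂_le fun t hP => ?_)
  rcases (zero_le (a := t)).eq_or_lt with rfl | ht
  · exact zero_le
  have ht' : 0 < (t : ℝ) := ht
  have htd := S.lt_dim_of_lowerPressure_pos hd hX hP
  obtain ⟨a, ha, hZ⟩ := (S.lowerPressure_pos_iff t).1 hP
  obtain ⟨K, hK⟩ := S.exists_isDistortion
  obtain ⟨x₀, hx₀⟩ := hX.nonempty
  have hKt : (K : ℝ≥0∞) ^ (t : ℝ) ≠ ⊤ := ENNReal.rpow_ne_top_of_nonneg ht'.le ENNReal.coe_ne_top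
  rcases H t ht' htd (a / 4) (by positivity) with ⟨hfin, hF⟩ | hF
  · have hK1 : (1 : ℝ) ≤ K := hK.one_le
    set κ : ℝ := (K : ℝ) ^ (t : ℝ) * (K : ℝ) ^ (t : ℝ) * (K : ℝ) ^ (t : ℝ) with hκ
    have hKt1 : (1 : ℝ) ≤ (K : ℝ) ^ (t : ℝ) := Real.one_le_rpow hK1 ht'.le
    have hκ1 : 1 ≤ κ := by
      rw [hκ]
      exact one_le_mul_of_one_le_of_one_le (one_le_mul_of_one_le_of_one_le hKt1 hKt1) hKt1
    have hexp : Real.exp (-(a / 4)) < 1 := by rw [Real.exp_lt_one_iff]; linarith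
    have hexp0 := Real.exp_pos (-(a / 4))
    -- Chosen so that the factor kept per level is exactly `exp (-(a / 4))`: the growth rate drops
    -- from `a` to `3a / 4`, still above the rate `a / 4` of the alphabets.
    set δ : ℝ := (1 - Real.exp (-(a / 4))) / κ with hδ
    have hδ0 : 0 < δ := div_pos (by linarith) (by linarith)
    have hδ1 : δ ≤ 1 := by
      rw [hδ, div_le_one (by linarith)]; linarith
    have hδκ : 1 - Real.exp (-(a / 4)) = δ * κ := by
      rw [hδ, div_mul_cancel₀ _ (by linarith)]
    obtain ⟨F, C, hC, hcard, hkeep⟩ := hF δ hδ0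
    have hmain := S.pow_mul_wordSum_le hK hd ht'.le hfin (F := fun n => F n) hδ0.le hδ1 hδκ hkeep
    refine S.le_dimH_of_exponential_growth hd hX (F := F) hx₀ (a := a * (3 / 4)) (ε := a / 4)
      hKt (by linarith) hC hcard ?_
    filter_upwards [hZ] with n hn
    have h1 : S.Z n t ≤ (K : ℝ≥0∞) ^ (t : ℝ) *
        S.wordSum (S.admissible (fun _ => univ) n) t x₀ := by
      rw [wordSum, S.admissible_univ, indicator_univ, Z, ← ENNReal.tsum_mul_left]
      refine ENNReal.tsum_le_tsum fun ω => ?_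
      rw [← ENNReal.mul_rpow_of_nonneg _ _ ht'.le]
      exact ENNReal.rpow_le_rpow (hK.wordNorm_le n ω (S.subset_V hx₀)) ht'.le
    have h2 := hmain n x₀ hx₀
    rw [sub_sub_cancel] at h2
    calc ENNReal.ofReal (Real.exp (a * (3 / 4) * n))
        = ENNReal.ofReal (Real.exp (-(a / 4))) ^ n * ENNReal.ofReal (Real.exp (a * n)) := by
          rw [← ENNReal.ofReal_pow hexp0.le, ← ENNReal.ofReal_mul (by positivity),
            ← Real.exp_nat_mul, ← Real.exp_add]
          congr 2
          ring
      _ ≤ ENNReal.ofReal (Real.exp (-(a / 4))) ^ n * ((K : ℝ≥0∞) ^ (t : ℝ) *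
            S.wordSum (S.admissible (fun _ => univ) n) t x₀) := by
          gcongr
          exact hn.trans h1
      _ = (K : ℝ≥0∞) ^ (t : ℝ) * (ENNReal.ofReal (Real.exp (-(a / 4))) ^ n *
            S.wordSum (S.admissible (fun _ => univ) n) t x₀) := by ring
      _ ≤ _ := by gcongr
  -- The two powers of `K` pay for distortion in `pow_le_wordSum`, leaving growth by `exp a` per
  -- level.
  · obtain ⟨F, C, hC, hcard, hkeep⟩ := hF (K ^ (t : ℝ) * K ^ (t : ℝ) * (Real.exp a).toNNReal)
    have hgrow := S.pow_le_wordSum hK hd ht'.le (F := fun n => F n)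
      (D := ENNReal.ofReal (Real.exp a)) (fun n => by
        refine le_trans (le_of_eq ?_) (hkeep n)
        rw [ENNReal.coe_mul, ENNReal.coe_mul, ENNReal.coe_rpow_of_nonneg _ ht'.le]
        rfl)
    refine S.le_dimH_of_exponential_growth hd hX (F := F) hx₀ (a := a) (ε := a / 4)
      ENNReal.one_ne_top (by linarith) hC hcard (Eventually.of_forall fun n => ?_)
    rw [one_mul]
    refine le_trans (le_of_eq ?_) (hgrow n x₀ hx₀)
    rw [← ENNReal.ofReal_pow (Real.exp_pos _).le, ← Real.exp_nat_mul, mul_comm]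

end NCIFS

/-! ### The classes `𝓜`, `EV` and `𝓜₊`. -/

theorem tendsto_div_one {u T : ℕ → ℝ≥0∞} (hT0 : ∀ n, T n ≠ 0) (hTt : ∀ n, T n ≠ ⊤)
    (huT : ∀ n, u n ≤ T n)
    (h : ∀ δ : ℝ, 0 < δ → ∀ᶠ n in atTop, ENNReal.ofReal (1 - δ) * T n ≤ u n) :
    Tendsto (fun n => u n / T n) atTop (𝓝 1) := by
  rw [tendsto_order]
  refine ⟨fun b hb => ?_, fun b hb => Eventually.of_forall fun n => ?_⟩
  · have hbt : b ≠ ⊤ := (hb.trans ENNReal.one_lt_top).ne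
    have hb1 : b.toReal < 1 := by
      rw [← ENNReal.toReal_one]
      exact (ENNReal.toReal_lt_toReal hbt ENNReal.one_ne_top).2 hb
    filter_upwards [h ((1 - b.toReal) / 2) (by linarith)] with n hn
    have h1 : ENNReal.ofReal (1 - (1 - b.toReal) / 2) ≤ u n / T n :=
      (ENNReal.le_div_iff_mul_le (Or.inl (hT0 n)) (Or.inl (hTt n))).2 hn
    exact ((ENNReal.lt_ofReal_iff_toReal_lt hbt).2 (by linarith)).trans_le h1
  · exact (ENNReal.div_le_of_le_mul (by rw [one_mul]; exact huT n)).trans_lt hb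

namespace NCIFS

variable {d : ℕ} {X : Set (E d)} (S : NCIFS X)

theorem tendsto_exp_mul_succ {ε : ℝ} (hε : 0 < ε) :
    Tendsto (fun n : ℕ => Real.exp (ε * ((n : ℝ) + 1))) atTop atTop :=
  Real.tendsto_exp_atTop.comp
    ((tendsto_atTop_add_const_right _ 1 tendsto_natCast_atTop_atTop).const_mul_atTop hε)

/-- A tail property of the truncations at the letters up to `exp (ε (n + 1))` can be upgraded
to a property of all levels by changing finitely many truncations. -/
theorem exists_truncation {ε : ℝ} (hε : 0 < ε) (Q : ℕ → Set ℕ → Prop)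
    (hex : ∀ n, ∃ G : Finset ℕ, Q n G)
    (hev : ∀ᶠ n : ℕ in atTop, Q n {k | (k : ℝ) + 1 ≤ Real.exp (ε * ((n : ℝ) + 1))}) :
    ∃ (F : ℕ → Finset ℕ) (C : ℝ), 0 ≤ C ∧ (∀ n, ((F n).card : ℝ) ≤ C * Real.exp (ε * n)) ∧
      ∀ n, Q n (F n) := by
  choose G hG using hex
  obtain ⟨n₀, hn₀⟩ := eventually_atTop.1 hev
  -- The constant `exp ε` absorbs the shift from `n + 1` to `n`; the sum of cardinalities absorbs
  -- the finitely many exceptional levels.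
  refine ⟨fun n => if n < n₀ then G n else Finset.range ⌊Real.exp (ε * ((n : ℝ) + 1))⌋₊,
    Real.exp ε + ∑ n ∈ Finset.range n₀, ((G n).card : ℝ), by positivity, fun n => ?_, fun n => ?_⟩
  · have hsum : 0 ≤ ∑ n ∈ Finset.range n₀, ((G n).card : ℝ) := by positivity
    have hexp : 1 ≤ Real.exp (ε * n) := Real.one_le_exp (by positivity)
    dsimp only
    by_cases hn : n < n₀
    · rw [if_pos hn]
      have h1 : ((G n).card : ℝ) ≤ ∑ n ∈ Finset.range n₀, ((G n).card : ℝ) :=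
        Finset.single_le_sum (f := fun n => ((G n).card : ℝ)) (fun _ _ => by positivity)
          (Finset.mem_range.2 hn)
      have h2 := Real.exp_pos ε
      nlinarith
    · rw [if_neg hn, Finset.card_range]
      calc ((⌊Real.exp (ε * ((n : ℝ) + 1))⌋₊ : ℕ) : ℝ) ≤ Real.exp (ε * ((n : ℝ) + 1)) :=
            Nat.floor_le (Real.exp_pos _).le
        _ = Real.exp ε * Real.exp (ε * n) := by rw [← Real.exp_add]; congr 1; ring
        _ ≤ _ := by gcongr; linarith
  · dsimp only
    by_cases hn : n < n₀
    · rw [if_pos hn]; exact hG n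
    · rw [if_neg hn, ← setOf_add_one_le_eq (Real.exp_pos _).le]
      exact hn₀ n (not_lt.1 hn)

theorem bowenFormula_of_inClassM (hd : 0 < d) (hX : IsPhaseSpace X) (hS : S.InClassM) :
    S.BowenFormula := by
  refine S.bowenFormula_of_truncation hd hX fun t ht0 htd ε hε => ?_
  obtain ⟨hdich, hfin, hinf⟩ := hS.2 t ht0 htd ε hε
  rcases hdich with h | h
  · right
    intro D
    refine exists_truncation hε (fun n F => (D : ℝ≥0∞) ≤ S.restrictedSum n F t) (fun n => ?_) ?_
    · exact S.exists_finset_le_restrictedSum n t (by rw [h n]; exact ENNReal.coe_lt_top)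
    · filter_upwards [(hinf h).eventually_const_lt (ENNReal.coe_lt_top (r := D))] with n hn
      rw [← levelSumUpTo_eq]
      exact hn.le
  · left
    refine ⟨h, fun δ hδ => ?_⟩
    have hlt : ENNReal.ofReal (1 - δ) < 1 := by
      rw [← ENNReal.ofReal_one]
      exact (ENNReal.ofReal_lt_ofReal_iff one_pos).2 (by linarith)
    refine exists_truncation hε
      (fun n F => ENNReal.ofReal (1 - δ) * S.levelSum n t ≤ S.restrictedSum n F t)
      (fun n => ?_) ?_
    -- A finite set is extracted from the strict inequality between `(1 - δ)` times the level sum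
    -- and the level sum, which fails when the latter is 0; then the empty set serves.
    · by_cases h0 : S.levelSum n t = 0
      · exact ⟨∅, by rw [h0, mul_zero]; exact zero_le⟩
      · refine S.exists_finset_le_restrictedSum n t ?_
        have := ENNReal.mul_lt_mul_left h0 (h n).ne hlt
        rwa [one_mul] at this
    · filter_upwards [(hfin h).eventually_const_lt hlt] with n hn
      rw [← levelSumUpTo_eq]
      exact ENNReal.mul_le_of_le_div hn.le

/-- The bound `M` is uniform in the level, so the same finite set of letters truncates every
alphabet, finite or infinite, and no growth of cardinality occurs. -/
theorem bowenFormula_of_inClassMPlus (hd : 0 < d) (hX : IsPhaseSpace X) (hS : S.InClassMPlus) :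
    S.BowenFormula := by
  refine S.bowenFormula_of_truncation hd hX fun t ht0 htd ε hε => ?_
  have hM := hS.2.2.2 t ht0.le htd.le
  have hcard : ∀ M n : ℕ, ((Finset.range M).card : ℝ) ≤ M * Real.exp (ε * n) := fun M n => by
    rw [Finset.card_range]
    exact le_mul_of_one_le_right (Nat.cast_nonneg M) (Real.one_le_exp (by positivity))
  have hup : ∀ n M : ℕ, S.levelSumUpTo n M t = S.restrictedSum n (Finset.range M) t := by
    intro n M
    rw [levelSumUpTo_eq, setOf_add_one_le_eq (Nat.cast_nonneg M), Nat.floor_natCast]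
  obtain ⟨-, -, hdich, -, -⟩ := hM 1 one_pos
  rcases hdich with h | h
  · right
    intro D
    obtain ⟨M, -, -, -, hinf⟩ := hM (1 / (D + 1)) (by positivity)
    refine ⟨fun _ => Finset.range M, M, Nat.cast_nonneg M, hcard M, fun n => ?_⟩
    rw [← hup]
    refine le_trans ?_ (hinf h n)
    rw [one_div_one_div, ← ENNReal.ofReal_coe_nnreal]
    exact ENNReal.ofReal_le_ofReal (by linarith)
  · left
    refine ⟨h, fun δ hδ => ?_⟩
    obtain ⟨M, -, -, hfin, -⟩ := hM δ hδ
    refine ⟨fun _ => Finset.range M, M, Nat.cast_nonneg M, hcard M, fun n => ?_⟩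
    rw [← hup]
    exact hfin h n

theorem levelSumUpTo_mono (n : ℕ) {R R' : ℝ} (h : R ≤ R') (t : ℝ) :
    S.levelSumUpTo n R t ≤ S.levelSumUpTo n R' t := by
  rw [levelSumUpTo_eq, levelSumUpTo_eq]
  exact S.restrictedSum_mono n (fun k hk => le_trans hk h) t

theorem levelSumUpTo_le (n : ℕ) (R t : ℝ) : S.levelSumUpTo n R t ≤ S.levelSum n t := by
  rw [levelSumUpTo_eq]
  exact S.restrictedSum_le_levelSum n _ t

theorem levelSum_ne_zero (hd : 0 < d) (hne : X.Nonempty) (hS : S.IsInfinite) (n : ℕ) {t : ℝ}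
    (ht : 0 ≤ t) : S.levelSum n t ≠ 0 := by
  obtain ⟨x, hx⟩ := hne
  have h0 : 0 ∈ S.index n := by rw [hS n]; exact mem_univ 0
  intro h
  have h1 := ENNReal.tsum_eq_zero.1 h ⟨0, h0⟩
  have hpos : 0 < S.letterNorm n ⟨0, h0⟩ :=
    (pos_iff_ne_zero.2 (S.letterDeriv_ne_zero hd n _ (S.subset_V hx))).trans_le
      (S.letterDeriv_le_letterNorm n _ hx)
  exact (ENNReal.rpow_pos_of_nonneg hpos ht).ne' h1

/-- The fixed cut-off `M` is eventually below `exp (ε (n + 1))`, and truncated sums increase with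
the cut-off. -/
theorem inClassM_of_inClassMPlus (hd : 0 < d) (hX : IsPhaseSpace X) (hS : S.InClassMPlus)
    (hinf : S.IsInfinite) : S.InClassM := by
  refine ⟨hinf, fun t ht0 htd ε hε => ?_⟩
  have hM := hS.2.2.2 t ht0.le htd.le
  have hdich := (hM 1 one_pos).choose_spec.2.1
  refine ⟨hdich, fun h => ?_, fun h => ?_⟩
  · refine tendsto_div_one (fun n => S.levelSum_ne_zero hd hX.nonempty hinf n ht0.le)
      (fun n => (h n).ne) (fun n => S.levelSumUpTo_le _ _ _) fun δ hδ => ?_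
    obtain ⟨M, -, -, hfin, -⟩ := hM δ hδ
    filter_upwards [(tendsto_exp_mul_succ hε).eventually_ge_atTop (M : ℝ)] with n hn
    exact (hfin h n).trans (S.levelSumUpTo_mono n hn t)
  · rw [ENNReal.tendsto_nhds_top_iff_nnreal]
    intro D
    -- The resulting lower bound is `D + 1`; the extra 1 gives strictness and keeps the quotient
    -- meaningful for `D = 0`.
    obtain ⟨M, -, -, -, hD⟩ := hM (1 / (D + 1)) (by positivity)
    filter_upwards [(tendsto_exp_mul_succ hε).eventually_ge_atTop (M : ℝ)] with n hn
    refine lt_of_lt_of_le ?_ ((hD h n).trans (S.levelSumUpTo_mono n hn t))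
    rw [one_div_one_div, ← ENNReal.ofReal_coe_nnreal]
    exact (ENNReal.ofReal_lt_ofReal_iff (by positivity)).2 (by linarith)

theorem tsum_index_indicator (hS : S.IsInfinite) (n : ℕ) (F : Set ℕ) (g : ℕ → ℝ≥0∞) :
    ∑' a : S.index n, {a : S.index n | (a : ℕ) ∈ F}.indicator (fun a => g a) a =
      ∑' k, F.indicator g k := by
  have h := tsum_subtype (S.index n) (F.indicator g)
  -- The alphabet equals `univ` only through `hS`; rewriting there and back removes the outer
  -- indicator.
  rw [hS n, indicator_univ, ← hS n] at h
  rw [← h]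
  rfl

/-- Every restricted level sum is comparable, with the constant `κ = c ^ t`, to the corresponding
part of the single series `∑ γ_k^t`. Finiteness, tails and divergence are thus uniform in the level.
-/
theorem inClassM_of_evenlyVarying (hd : 0 < d) (hX : IsPhaseSpace X) (hS : S.EvenlyVarying) :
    S.InClassM := by
  obtain ⟨hinf, γ, c, hγ, hc, hγc⟩ := hS
  refine ⟨hinf, fun t ht0 htd ε hε => ?_⟩
  have hc0 : 0 < c := one_pos.trans_le hc
  set w : ℕ → ℝ≥0∞ := fun k => ENNReal.ofReal (γ k) ^ t with hw
  set κ : ℝ≥0∞ := ENNReal.ofReal c ^ t with hκ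
  have hκt : κ ≠ ⊤ := ENNReal.rpow_ne_top_of_nonneg ht0.le ENNReal.ofReal_ne_top
  have hκ0 : κ ≠ 0 :=
    (ENNReal.rpow_pos (ENNReal.ofReal_pos.2 hc0) ENNReal.ofReal_ne_top).ne'
  have hupper : ∀ n F, S.restrictedSum n F t ≤ κ * ∑' k, F.indicator w k := by
    intro n F
    rw [← S.tsum_index_indicator hinf n, ← ENNReal.tsum_mul_left]
    refine ENNReal.tsum_le_tsum fun a => indicator_apply_le' (fun ha => ?_) (fun _ => zero_le)
    rw [indicator_of_mem ha, hκ, hw, ← ENNReal.mul_rpow_of_nonneg _ _ ht0.le,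
      ← ENNReal.ofReal_mul hc0.le]
    exact ENNReal.rpow_le_rpow (hγc n a).2 ht0.le
  have hlower : ∀ n F, ∑' k, F.indicator w k ≤ κ * S.restrictedSum n F t := by
    intro n F
    rw [← S.tsum_index_indicator hinf n, restrictedSum, ← ENNReal.tsum_mul_left]
    refine ENNReal.tsum_le_tsum fun a => indicator_apply_le' (fun ha => ?_) (fun _ => zero_le)
    rw [indicator_of_mem ha, hκ, ← ENNReal.mul_rpow_of_nonneg _ _ ht0.le]
    refine ENNReal.rpow_le_rpow ?_ ht0.le
    calc ENNReal.ofReal (γ a) = ENNReal.ofReal c * ENNReal.ofReal (γ a / c) := by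
          rw [← ENNReal.ofReal_mul hc0.le, mul_div_cancel₀ _ hc0.ne']
      _ ≤ _ := by gcongr; exact (hγc n a).1
  have huniv : ∀ n, S.restrictedSum n univ t = S.levelSum n t := fun n =>
    tsum_congr fun a => indicator_of_mem (mem_univ _) _
  have hup : ∀ n, S.levelSum n t ≤ κ * ∑' k, w k := fun n => by
    have := hupper n univ
    rwa [huniv, indicator_univ] at this
  have hlo : ∀ n, ∑' k, w k ≤ κ * S.levelSum n t := fun n => by
    have := hlower n univ
    rwa [huniv, indicator_univ] at this
  set R : ℕ → ℕ := fun n => ⌊Real.exp (ε * ((n : ℝ) + 1))⌋₊ with hR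
  have hRlim : Tendsto R atTop atTop := tendsto_nat_floor_atTop.comp (tendsto_exp_mul_succ hε)
  have hupTo : ∀ n : ℕ, S.levelSumUpTo n (Real.exp (ε * ((n : ℝ) + 1))) t =
      S.restrictedSum n (Finset.range (R n)) t := fun n => by
    rw [levelSumUpTo_eq, setOf_add_one_le_eq (Real.exp_pos _).le]
  refine ⟨?_, fun h => ?_, fun h => ?_⟩
  · by_cases hG : ∑' k, w k = ⊤
    · left
      intro n
      by_contra hne
      exact ENNReal.mul_ne_top hκt hne (top_le_iff.1 (hG ▸ hlo n))
    · right
      exact fun n => (hup n).trans_lt (ENNReal.mul_lt_top hκt.lt_top (lt_top_iff_ne_top.2 hG))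
  · have hG : ∑' k, w k ≠ ⊤ := ne_top_of_le_ne_top (ENNReal.mul_ne_top hκt (h 0).ne) (hlo 0)
    have hG0 : ∑' k, w k ≠ 0 := fun h0 =>
      S.levelSum_ne_zero hd hX.nonempty hinf 0 ht0.le (by
        have := hup 0
        rw [h0, mul_zero] at this
        exact nonpos_iff_eq_zero.1 this)
    refine tendsto_div_one (fun n => S.levelSum_ne_zero hd hX.nonempty hinf n ht0.le)
      (fun n => (h n).ne) (fun n => S.levelSumUpTo_le _ _ _) fun δ hδ => ?_
    have htail : Tendsto (fun n => ∑' k, ((Finset.range (R n) : Set ℕ)ᶜ).indicator w k) atTop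
        (𝓝 0) := by
      have h1 := (ENNReal.tendsto_tsum_compl_atTop_zero hG).comp
        (tendsto_finset_range.comp hRlim)
      refine h1.congr fun n => ?_
      exact tsum_subtype ((Finset.range (R n) : Set ℕ)ᶜ) w
    -- One `κ` is lost in bounding the tail by that of the series, the other in returning from the
    -- series to the level sum.
    have hpos : 0 < ENNReal.ofReal δ * (∑' k, w k) / (κ * κ) :=
      ENNReal.div_pos (mul_ne_zero (ENNReal.ofReal_pos.2 hδ).ne' hG0) (ENNReal.mul_ne_top hκt hκt)
    filter_upwards [htail.eventually_lt_const hpos] with n hn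
    refine ofReal_one_sub_mul_le hδ.le (h n).ne ?_
    rw [hupTo]
    conv_lhs => rw [S.levelSum_eq_add n (Finset.range (R n)) t]
    gcongr
    have h2 : κ * κ * ∑' k, ((Finset.range (R n) : Set ℕ)ᶜ).indicator w k ≤
        ENNReal.ofReal δ * ∑' k, w k := by
      rw [mul_comm]
      exact ENNReal.mul_le_of_le_div hn.le
    have h3 : κ * S.restrictedSum n (Finset.range (R n) : Set ℕ)ᶜ t ≤
        κ * (ENNReal.ofReal δ * S.levelSum n t) := by
      calc _ ≤ κ * (κ * ∑' k, ((Finset.range (R n) : Set ℕ)ᶜ).indicator w k) := by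
            gcongr
            exact hupper n _
        _ = κ * κ * ∑' k, ((Finset.range (R n) : Set ℕ)ᶜ).indicator w k := by ring
        _ ≤ ENNReal.ofReal δ * ∑' k, w k := h2
        _ ≤ ENNReal.ofReal δ * (κ * S.levelSum n t) := by gcongr; exact hlo n
        _ = _ := by ring
    exact (ENNReal.mul_le_mul_iff_right hκ0 hκt).1 h3
  · have hG : ∑' k, w k = ⊤ := by
      by_contra hne
      have := hup 0
      rw [h 0] at this
      exact ENNReal.mul_ne_top hκt hne (top_le_iff.1 this)
    have h1 : Tendsto (fun n => ∑ k ∈ Finset.range (R n), w k) atTop (𝓝 ⊤) := by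
      rw [← hG]
      exact (ENNReal.tendsto_nat_tsum w).comp hRlim
    have h2 : Tendsto (fun n => κ⁻¹ * ∑ k ∈ Finset.range (R n), w k) atTop (𝓝 ⊤) := by
      have := ENNReal.Tendsto.const_mul (a := κ⁻¹) h1 (Or.inr (ENNReal.inv_ne_top.2 hκ0))
      rwa [ENNReal.mul_top (ENNReal.inv_ne_zero.2 hκt)] at this
    refine tendsto_nhds_top_mono h2 (Eventually.of_forall fun n => ?_)
    change κ⁻¹ * _ ≤ S.levelSumUpTo n (Real.exp (ε * ((n : ℝ) + 1))) t
    rw [hupTo, ENNReal.inv_mul_le_iff hκ0 hκt]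
    refine le_trans (le_of_eq ?_) (hlower n _)
    rw [tsum_eq_sum (s := Finset.range (R n))
      (fun k hk => indicator_of_notMem (by simpa using hk) _)]
    exact Finset.sum_congr rfl fun k hk => (indicator_of_mem (Finset.mem_coe.2 hk) _).symm

end NCIFS

end NonAutonomous

theorem mainTheorem7 {d : ℕ} (hd : 0 < d) (X : Set (NonAutonomous.E d))
    (hX : NonAutonomous.IsPhaseSpace X) (S : NonAutonomous.NCIFS X) :
    (S.InClassM → S.BowenFormula) ∧
    (S.EvenlyVarying → S.InClassM) ∧
    (S.EvenlyVarying → S.BowenFormula) ∧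
    (S.InClassMPlus → S.IsInfinite → S.InClassM) ∧
    (S.InClassMPlus → S.BowenFormula) :=
  ⟨S.bowenFormula_of_inClassM hd hX, S.inClassM_of_evenlyVarying hd hX,
    fun h => S.bowenFormula_of_inClassM hd hX (S.inClassM_of_evenlyVarying hd hX h),
    S.inClassM_of_inClassMPlus hd hX, S.bowenFormula_of_inClassMPlus hd hX⟩
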